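/- For real $\alpha,\beta,\gamma\in[0,1)$ and $n\ge 0$ let $r(\alpha,\beta,\gamma,n)=r_0r_1\cdots r_{n-1}$ be the binary word with $r_i=1$ if the fractional part $\{i\alpha\}$ lies in $[\beta,\gamma)$ and $r_i=0$ otherwise, where $[\beta,\gamma)$ means $[\beta,1)\cup[0,\gamma)$ when $\beta\ge\gamma$; such words are called rotation words. A Sturmian word of length $n$ and slope $\alpha$ is a word $r(\alpha,\beta,\gamma,n)$ with $\gamma-\beta\equiv\alpha\pmod 1$. A word $w=w_0w_1\cdots w_n$ is said to be generated by an ordered pair $(u,v)$ of Sturmian words $u=u_1\cdots u_n$, $v=v_1\cdots v_n$ of the same slope if $w_k=w_{k-1}+u_k-v_k$ (in $\mathbb Z$) for all $k=1,\dots,n$. **Theorem.** Suppose a rotation word $w$ contains at least two 0s and at least two 1s and is generated by at least two different pairs $(u,v)$ of Sturmian words of the same slope $\alpha\in(0,1/2)$ ($\alpha$ may depend on the pair). Then $w=0^i(10^l)^k10^j$ or $w=1^i(01^l)^k01^j$ for some integers $i,j\ge 0$, $l\ge 2$, $k\ge 1$, and the number of pairs $(u,v)$ of Sturmian words of the same slope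 in $(0,1/2)$ that generate $w$ is equal to $\varphi(l+1)/2$ if $i,j\le l$, and to $\varphi(l+1)$ otherwise, where $\varphi$ is Euler's totient function. -/

import Mathlib

namespace RotWord

/-- Finite binary words. -/
abbrev Word := List (Fin 2)

/-- The half-open arc `[β, γ)` of the circle `[0, 1)`: the usual interval if `β < γ`, and
`[β, 1) ∪ [0, γ)` otherwise. -/
noncomputable def arc (β γ : ℝ) : Set ℝ :=
  if β < γ then Set.Ico β γ else Set.Ico β 1 ∪ Set.Ico 0 γ

open Classical in
/-- The symbol `r_i` of the rotation word: `1` if `{i α} ∈ [β, γ)`, and `0` otherwise. -/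
noncomputable def letter (α β γ : ℝ) (i : ℕ) : Fin 2 :=
  if Int.fract (i * α) ∈ arc β γ then 1 else 0

/-- The word `r(α, β, γ, n) = r_0 ⋯ r_{n-1}`. -/
noncomputable def rot (α β γ : ℝ) (n : ℕ) : Word :=
  List.ofFn fun i : Fin n => letter α β γ i

/-- `w` is a (finite) rotation word. -/
def IsRotationWord (w : Word) : Prop :=
  ∃ α ∈ Set.Ico (0 : ℝ) 1, ∃ β ∈ Set.Ico (0 : ℝ) 1, ∃ γ ∈ Set.Ico (0 : ℝ) 1,
    w = rot α β γ w.length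

/-- `St(n, α)`: the Sturmian words of length `n` and slope `α`, that is, the words
`r(α, β, γ, n)` with `γ - β = α (mod 1)`. -/
def Sturmian (n : ℕ) (α : ℝ) : Set Word :=
  {u | ∃ β ∈ Set.Ico (0 : ℝ) 1, u = rot α β (Int.fract (β + α)) n}

/-- The word `w = r_0 ⋯ r_n` of length `n + 1` satisfies `r_k = r_{k-1} + u_k - v_k` for
`k = 1, …, n`, where `u = u_1 ⋯ u_n` and `v = v_1 ⋯ v_n`. The equation is between integers, and
all the indices that occur are in range; in the lists, `u_k` is the entry at position `k - 1`. -/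
def Recurrence (u v w : Word) : Prop :=
  w.length = u.length + 1 ∧ v.length = u.length ∧
    ∀ k < u.length, (((w.getD (k + 1) 0).val : ℕ) : ℤ) =
      ((w.getD k 0).val : ℤ) + ((u.getD k 0).val : ℤ) - ((v.getD k 0).val : ℤ)

/-- The ordered pairs of Sturmian words of the same slope `α < 1/2` that generate `w`. -/
def generatingPairs (w : Word) : Set (Word × Word) :=
  {p | ∃ α ∈ Set.Ioo (0 : ℝ) (1 / 2), p.1 ∈ Sturmian (w.length - 1) α ∧
    p.2 ∈ Sturmian (w.length - 1) α ∧ Recurrence p.1 p.2 w}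

/-- The word `a^i (b a^l)^k b a^j`. -/
def periodicForm (a b : Fin 2) (i l k j : ℕ) : Word :=
  List.replicate i a ++ (List.replicate k (b :: List.replicate l a)).flatten ++
    b :: List.replicate j a

end RotWord

/-! ### Integer points in a strip below a line -/

namespace RotWord

/-! When both letters occur in `w`, a generating pair comes from a line t ↦ tα + x and a width c: u
and v record the increments of ⌊tα + x⌋ and ⌊tα + x - c⌋, and w_t = 1 exactly when the strip of
vertical width c below the line contains an integer point at time t, a hit
(`mem_generatingPairs_iff`). The question becomes when two strips with the same hits have different
height increments.

If both 00 and 11 occur, the ones of u mark the factors 01, so the pair is unique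
(`IsRep.pair_eq_of_factors`). Exchanging the letters swaps u and v, so the ones may be assumed
isolated. Then consecutive hits differ by a primitive vector (d, p) with 1 ≤ p ≤ d/2, because α <
1/2, and adjacent vectors have determinant 0 or ±1 (`abs_cross_le_one`). Two unequal adjacent gaps
have determinant ±1, which determines both numerators; hence either all gaps are equal or the two
strips have the same height increments between hits (`height_sub_eq_or_gaps_eq`). In the latter case
the heights agree, up to a constant, from the first hit to the last. A disagreement outside that
range forces the offsets at the hits to increase strictly in one strip and to decrease strictly in
the other (`opposite_of_height_ne`), and monotone offsets again make all gaps equal (`gap_eq`). So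
the hits form a progression of difference d = l + 1. Here d = 2 is impossible: it forces p = 1, and
2α < 1 leaves only downward drift.

For a progression, p ranges over the φ(d)/2 residues prime to d below d/2, and each p is realised by
slopes (p ± δ)/d with either drift (`exists_strip`). For fixed p the direction of drift determines
the pair. The two directions give different pairs exactly when the word extends at least d beyond
the first or the last hit (`not_opposite`, `not_agree`), which gives φ(d)/2 or φ(d) pairs. -/

/-- The integer height of the line `t ↦ t α + x` at the time `t`. -/
noncomputable def height (α x : ℝ) (t : ℤ) : ℤ := ⌊t * α + x⌋

/-- The offset of the line `t ↦ t α + x` above its integer height at the time `t`. -/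
noncomputable def offset (α x : ℝ) (t : ℤ) : ℝ := t * α + x - height α x t

lemma offset_nonneg (α x : ℝ) (t : ℤ) : 0 ≤ offset α x t := by
  have := Int.floor_le (t * α + x)
  unfold offset height
  linarith

lemma offset_lt_one (α x : ℝ) (t : ℤ) : offset α x t < 1 := by
  have := Int.lt_floor_add_one (t * α + x)
  unfold offset height
  linarith

/-- In the time interval `[0, n]`, the set `H` consists of the times at which the strip of vertical
width `c` below the line `t ↦ t α + x` contains an integer point. -/
structure IsStrip (H : ℤ → Prop) (n : ℤ) (α x c : ℝ) : Prop where
  width_le : c ≤ 1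
  iff_offset : ∀ t, 0 ≤ t → t ≤ n → (H t ↔ offset α x t < c)

/-- `s < t` are consecutive elements of `H` in `[0, n]`. -/
def Consec (H : ℤ → Prop) (n s t : ℤ) : Prop :=
  0 ≤ s ∧ s < t ∧ t ≤ n ∧ H s ∧ H t ∧ ∀ r, s < r → r < t → ¬ H r

variable {H : ℤ → Prop} {n : ℤ} {α x c α' x' c' : ℝ}

lemma height_eq {t h : ℤ} (h0 : 0 ≤ t * α + x - h) (h1 : t * α + x - h < 1) :
    height α x t = h := by
  unfold height
  rw [Int.floor_eq_iff]
  constructor <;> linarith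

lemma le_height {t h : ℤ} : h ≤ height α x t ↔ 0 ≤ t * α + x - h := by
  unfold height
  rw [Int.le_floor, sub_nonneg]

namespace IsStrip

lemma mem (S : IsStrip H n α x c) {t h : ℤ} (ht : 0 ≤ t) (htn : t ≤ n)
    (h0 : 0 ≤ t * α + x - h) (h1 : t * α + x - h < c) : H t ∧ height α x t = h := by
  have e := height_eq h0 (h1.trans_le S.width_le)
  refine ⟨(S.iff_offset t ht htn).2 ?_, e⟩
  unfold offset
  rwa [e]

lemma not_mem_ge (S : IsStrip H n α x c) {t h : ℤ} (ht : 0 ≤ t) (htn : t ≤ n) (hH : ¬ H t)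
    (h0 : 0 ≤ t * α + x - h) : c ≤ t * α + x - h := by
  by_contra! h1
  exact hH (S.mem ht htn h0 h1).1

/-- The strip is convex: a common divisor g ≥ 2 would put an integer point of the segment joining
the two hits inside the strip, at a time strictly between them. -/
lemma isCoprime (S : IsStrip H n α x c) {s t : ℤ} (hst : Consec H n s t) :
    IsCoprime (t - s) (height α x t - height α x s) := by
  obtain ⟨hs, hlt, htn, Hs, Ht, hno⟩ := hst
  rw [Int.isCoprime_iff_gcd_eq_one]
  set g := Int.gcd (t - s) (height α x t - height α x s) with hg
  obtain ⟨d, hd⟩ : (g : ℤ) ∣ t - s := Int.gcd_dvd_left ..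
  obtain ⟨p, hp⟩ : (g : ℤ) ∣ height α x t - height α x s := Int.gcd_dvd_right ..
  have hg0 : g ≠ 0 := by
    intro h0
    rw [h0] at hd
    simp at hd
    omega
  by_contra hg1
  have hg2 : (2 : ℤ) ≤ g := by omega
  have hd0 : 0 < d := by nlinarith
  have hd1 : d < t - s := by nlinarith
  have hos := (S.iff_offset s hs (by omega)).1 Hs
  have hot := (S.iff_offset t (by omega) htn).1 Ht
  have hos0 := offset_nonneg α x s
  have hot0 := offset_nonneg α x t
  have hdR : (t - s : ℝ) = g * d := by exact_mod_cast hd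
  have hpR : (height α x t - height α x s : ℝ) = g * p := by exact_mod_cast hp
  have hgR : (2 : ℝ) ≤ g := by exact_mod_cast hg2
  have key : offset α x t - offset α x s = g * (d * α - p) := by
    unfold offset
    linear_combination α * hdR - hpR
  have hpt : ((s + d : ℤ) : ℝ) * α + x - ((height α x s + p : ℤ) : ℝ)
      = offset α x s + (d * α - p) := by
    unfold offset
    push_cast
    ring
  refine hno (s + d) (by omega) (by omega)
    (S.mem (h := height α x s + p) (by omega) (by omega) ?_ ?_).1 <;> rw [hpt]
  · rcases le_total 0 (d * α - p) with h | h <;> nlinarith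
  · rcases le_total 0 (d * α - p) with h | h <;> nlinarith

/-- The triangle on three consecutive integer points of a strip contains no further one, so it is
degenerate or unimodular. -/
lemma abs_cross_le_one (S : IsStrip H n α x c) {s t r : ℤ} (hst : Consec H n s t)
    (htr : Consec H n t r) :
    |(t - s) * (height α x r - height α x t) - (height α x t - height α x s) * (r - t)| ≤ 1 := by
  by_contra! hD
  obtain ⟨b₀, a₀, hab⟩ := S.isCoprime hst
  obtain ⟨hs, hlt, htn, Hs, Ht, hno⟩ := hst
  obtain ⟨-, hlt', hrn, -, Hr, hno'⟩ := htr
  set p := height α x t - height α x s with hp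
  set p' := height α x r - height α x t with hp'
  set D₀ := (t - s) * p' - p * (r - t) with hD₀
  obtain ⟨σ, hσ, hσ2⟩ : ∃ σ : ℤ, |D₀| = σ * D₀ ∧ σ * σ = 1 := by
    rcases abs_cases D₀ with h | h
    · exact ⟨1, by omega, by norm_num⟩
    · exact ⟨-1, by omega, by norm_num⟩
  set D := |D₀| with hDdef
  -- By Bézout, (r - t, p') = m₀ (t - s, p) + D₀ (-a₀, b₀). Reducing m₀ modulo D makes (r - t, p') -
  -- m (t - s, p) equal to D times an integer vector (a, b) with 0 ≤ m < D.
  set m₀ := b₀ * (r - t) + a₀ * p' with hm₀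
  have hm := Int.emod_nonneg m₀ (show D ≠ 0 by omega)
  have hm' := Int.emod_lt_of_pos m₀ (show 0 < D by omega)
  have hmq := Int.mul_ediv_add_emod m₀ D
  set m := m₀ % D
  set k := m₀ / D
  set a := -σ * a₀ + k * (t - s) with ha
  set b := σ * b₀ + k * p with hb
  have hDa : D * a = (r - t) - m * (t - s) := by
    linear_combination (-a₀ * σ) * hσ + (-a₀ * D₀) * hσ2 + (t - s) * hmq + (r - t) * hab
  have hDb : D * b = p' - m * p := by
    linear_combination (b₀ * σ) * hσ + (b₀ * D₀) * hσ2 + p * hmq + p' * hab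
  have ha1 : a < r - t := by nlinarith
  have ha2 : -(t - s) < a := by nlinarith
  have hos := (S.iff_offset s hs (by omega)).1 Hs
  have hot := (S.iff_offset t (by omega) htn).1 Ht
  have hor := (S.iff_offset r (by omega) hrn).1 Hr
  have hos0 := offset_nonneg α x s
  have hot0 := offset_nonneg α x t
  have hor0 := offset_nonneg α x r
  have hDaR : (D * a : ℝ) = (r - t) - m * (t - s) := by exact_mod_cast hDa
  have hDbR : (D * b : ℝ) = (height α x r - height α x t : ℝ) -
    m * (height α x t - height α x s : ℝ) := by exact_mod_cast hDb
  have hmR : (0 : ℝ) ≤ m := by exact_mod_cast hm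
  have hmR' : (m : ℝ) + 1 ≤ D := by exact_mod_cast hm'
  -- The new integer point is a convex combination of the three hits, with weights (D - 1 - m)/D,
  -- 1/D and m/D, so it lies in the strip.
  have key : D * (offset α x t + (a * α - b)) =
      (D - 1 - m) * offset α x t + offset α x r + m * offset α x s := by
    unfold offset
    linear_combination α * hDaR - hDbR
  have hpt : ((t + a : ℤ) : ℝ) * α + x - ((height α x t + b : ℤ) : ℝ)
      = offset α x t + (a * α - b) := by
    unfold offset
    push_cast
    ring
  have hDpos : (0 : ℝ) < D := by linarith
  obtain ⟨hH, hh⟩ := S.mem (t := t + a) (h := height α x t + b) (by omega) (by omega)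
    (by
      rw [hpt]
      refine nonneg_of_mul_nonneg_right ?_ hDpos
      rw [key]
      have : (0 : ℝ) ≤ D - 1 - m := by linarith
      positivity)
    (by
      rw [hpt]
      refine lt_of_mul_lt_mul_left ?_ hDpos.le
      rw [key]
      have : (D - 1 - m) * offset α x t ≤ (D - 1 - m) * c :=
        mul_le_mul_of_nonneg_left hot.le (by linarith)
      have : m * offset α x s ≤ m * c := mul_le_mul_of_nonneg_left hos.le hmR
      linarith)
  rcases lt_trichotomy a 0 with h | h | h
  · exact hno (t + a) (by omega) (by omega) hH
  · rw [h, add_zero] at hh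
    have hb0 : b = 0 := by omega
    rw [h] at hDa
    rw [hb0] at hDb
    have e1 : D₀ = 0 := by
      rw [hD₀]
      linear_combination (-(t - s)) * hDb + p * hDa
    rw [e1, abs_zero] at hDdef
    omega
  · exact hno' (t + a) (by omega) (by omega) hH

/-- An increment 0 is not coprime to a gap at least 2. For the upper bound, 2α < 1 puts the point
two steps left of the later hit and one below it under the line. If the gap exceeds 2, that point is
at a time without a hit, so it lies below the whole strip and hence below the chord of the two hits.
-/
lemma two_mul_le (S : IsStrip H n α x c) (hα₀ : 0 ≤ α) (hα : α < 1 / 2) {s t : ℤ} (hst : Consec H n s t)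
    (h2 : 2 ≤ t - s) :
    1 ≤ height α x t - height α x s ∧ 2 * (height α x t - height α x s) ≤ t - s := by
  obtain ⟨hs, hlt, htn, Hs, Ht, hno⟩ := id hst
  have hcop := S.isCoprime hst
  have hos := (S.iff_offset s hs (by omega)).1 Hs
  have hot := (S.iff_offset t (by omega) htn).1 Ht
  have hos0 := offset_nonneg α x s
  have hot0 := offset_nonneg α x t
  set p := height α x t - height α x s with hp
  have hpR : (p : ℝ) = height α x t - height α x s := by exact_mod_cast hp
  have key : offset α x t - offset α x s = (t - s : ℝ) * α - p := by
    unfold offset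
    linear_combination hpR
  have hlt1 := offset_lt_one α x t
  have hlt2 := offset_lt_one α x s
  have htsR : (0 : ℝ) < t - s := by exact_mod_cast (by omega : (0 : ℤ) < t - s)
  have hp0 : 0 ≤ p := by
    have : (-1 : ℝ) < p := by nlinarith
    have : (-1 : ℤ) < p := by exact_mod_cast this
    omega
  constructor
  · by_contra h
    have hp0 : p = 0 := by omega
    rw [hp0, isCoprime_zero_right, Int.isUnit_iff] at hcop
    omega
  · have hq : p - 1 ≤ height α x (t - 2) - height α x s := by
      have : height α x t - 1 ≤ height α x (t - 2) := by
        rw [le_height]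
        unfold offset at hot0
        push_cast
        linarith
      omega
    rcases eq_or_ne (t - s) 2 with h | h
    · have : p < 2 := by
        have h' : (t - s : ℝ) = 2 := by exact_mod_cast h
        rw [h'] at key
        have : (p : ℝ) < 2 := by linarith
        exact_mod_cast this
      omega
    · have hq' : p - 1 + height α x s ≤ height α x (t - 2) := by omega
      rw [le_height] at hq'
      have hge := S.not_mem_ge (by omega) (by omega) (hno (t - 2) (by omega) (by omega)) hq'
      have e : ((t - 2 : ℤ) : ℝ) * α + x - ((p - 1 + height α x s : ℤ) : ℝ) =
          offset α x s + (t - 2 - s) * α - (p - 1) := by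
        unfold offset
        push_cast
        ring
      rw [e] at hge
      have h2 : (2 : ℝ) < t - s := by exact_mod_cast (by omega : (2 : ℤ) < t - s)
      have e2 : (t - s : ℝ) * (offset α x s + (t - 2 - s) * α - (p - 1)) =
          (t - s - 2) * offset α x t + 2 * offset α x s + (t - s - 2 * p) := by
        linear_combination (-(t - s - 2 : ℝ)) * key
      have h3 := mul_le_mul_of_nonneg_left hge htsR.le
      have h4 : (t - s - 2 : ℝ) * offset α x t < (t - s - 2) * c :=
        mul_lt_mul_of_pos_left hot (by linarith)
      have : (0 : ℝ) < t - s - 2 * p := by linarith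
      have : (0 : ℤ) < t - s - 2 * p := by exact_mod_cast this
      omega

/-- Two consecutive increments of the offset that have the same sign belong to equal gaps. -/
lemma gap_eq (S : IsStrip H n α x c) {s t r : ℤ} (hst : Consec H n s t) (htr : Consec H n t r)
    (h : offset α x s < offset α x t ∧ offset α x t < offset α x r ∨
      offset α x t < offset α x s ∧ offset α x r < offset α x t) : t - s = r - t := by
  obtain ⟨hs, hlt, htn, Hs, Ht, hno⟩ := hst
  obtain ⟨-, hlt', hrn, -, Hr, hno'⟩ := htr
  have hos := (S.iff_offset s hs (by omega)).1 Hs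
  have hor := (S.iff_offset r (by omega) hrn).1 Hr
  have hos0 := offset_nonneg α x s
  have hor0 := offset_nonneg α x r
  have hpt : ((s + (r - t) : ℤ) : ℝ) * α + x -
      ((height α x s + (height α x r - height α x t) : ℤ) : ℝ)
      = offset α x s + (offset α x r - offset α x t) := by
    unfold offset
    push_cast
    ring
  -- Applying the second gap vector at the first hit gives an offset between those at s and r, hence
  -- a hit strictly between s and r; the only one there is t.
  have hH := (S.mem (t := s + (r - t)) (h := height α x s + (height α x r - height α x t))
    (by omega) (by omega) (by rw [hpt]; rcases h with h | h <;> linarith)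
    (by rw [hpt]; rcases h with h | h <;> linarith)).1
  rcases lt_trichotomy (s + (r - t)) t with h | h | h
  · exact absurd hH (hno _ (by omega) h)
  · omega
  · exact absurd hH (hno' _ h (by omega))

end IsStrip
end RotWord
-- Two strips with the same hits
namespace RotWord
namespace IsStrip
variable {H : ℤ → Prop} {n : ℤ} {α x c α' x' c' : ℝ}

/-- At r the highest integer point under the first line is at least c below it, while both hits are
less than c below. So it lies under the chord of the hits, which in turn lies on or under the second
line. -/
lemma height_le_of_consec (S : IsStrip H n α x c) {s t r : ℤ}
    (hst : Consec H n s t) (hs : height α x s = height α' x' s)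
    (ht : height α x t = height α' x' t) (hsr : s < r) (hrt : r < t) :
    height α x r ≤ height α' x' r := by
  obtain ⟨hs0, hlt, htn, Hs, Ht, hno⟩ := id hst
  have hge := S.not_mem_ge (by omega) (by omega) (hno r hsr hrt) (le_height.1 le_rfl)
  have hos := (S.iff_offset s hs0 (by omega)).1 Hs
  have hot := (S.iff_offset t (by omega) htn).1 Ht
  rw [le_height]
  by_contra! hneg
  have hos0 := offset_nonneg α' x' s
  have hot0 := offset_nonneg α' x' t
  have h1 : (0 : ℝ) < r - s := by exact_mod_cast (by omega : (0 : ℤ) < r - s)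
  have h2 : (0 : ℝ) < t - r := by exact_mod_cast (by omega : (0 : ℤ) < t - r)
  have e1 : (t - s : ℝ) * (r * α + x - height α x r) = (t - r) * offset α x s +
      (r - s) * offset α x t - ((t - s) * (height α x r - height α x s) -
      (height α x t - height α x s) * (r - s)) := by
    unfold offset
    ring
  have e2 : (t - s : ℝ) * (r * α' + x' - height α x r) = (t - r) * offset α' x' s +
      (r - s) * offset α' x' t - ((t - s) * (height α x r - height α x s) -
      (height α x t - height α x s) * (r - s)) := by
    unfold offset
    rw [← hs, ← ht]
    ring
  have h3 : (t - s : ℝ) * c ≤ (t - s) * (r * α + x - height α x r) :=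
    mul_le_mul_of_nonneg_left hge (by linarith)
  have h4 : (t - s : ℝ) * (r * α' + x' - height α x r) < 0 :=
    mul_neg_of_pos_of_neg (by linarith) hneg
  have h5 : (t - r) * offset α x s < (t - r) * c := mul_lt_mul_of_pos_left hos h2
  have h6 : (r - s) * offset α x t < (r - s) * c := mul_lt_mul_of_pos_left hot h1
  have h7 : 0 ≤ (t - r) * offset α' x' s := mul_nonneg h2.le hos0
  have h8 : 0 ≤ (r - s) * offset α' x' t := mul_nonneg h1.le hot0
  linarith

/-- Heights of two strips with the same set of hits first differ at `τ`, after all the hits. -/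
lemma opposite_of_after (S : IsStrip H n α x c) (S' : IsStrip H n α' x' c') {τ : ℤ}
    (hτ : τ ≤ n) (hl : height α' x' τ < height α x τ) {s t : ℤ} (hst : Consec H n s t)
    (hts : t < τ) (hH : ¬ H τ) (hs : height α x s = height α' x' s)
    (ht : height α x t = height α' x' t)
    (hagree : height α x (τ - (t - s)) = height α' x' (τ - (t - s))) :
    H (τ - (t - s)) ∧ offset α x s < offset α x t ∧ offset α' x' t < offset α' x' s := by
  obtain ⟨hs0, hlt, htn, Hs, Ht, hno⟩ := id hst
  have hge := S.not_mem_ge (by omega) (by omega) hH (le_height.1 le_rfl)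
  rw [← not_le, le_height] at hl
  push Not at hl
  have hos := (S.iff_offset s hs0 (by omega)).1 Hs
  have hot := (S.iff_offset t (by omega) htn).1 Ht
  have hos0 := offset_nonneg α x s
  have hos' := (S'.iff_offset s hs0 (by omega)).1 Hs
  have hot0' := offset_nonneg α' x' t
  -- Translate the point at τ, which is under the first line and above the second, back by the gap
  -- vector. It stays under the first line, by agreement of heights it is then under the second, and
  -- it is in the second strip. So it is a hit, and comparing depths before and after the
  -- translation gives both drifts.
  set h := height α x τ - (height α x t - height α x s) with hh
  have e1 : ((τ - (t - s) : ℤ) : ℝ) * α + x - h =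
      (τ * α + x - height α x τ) - (offset α x t - offset α x s) := by
    rw [hh]
    unfold offset
    push_cast
    ring
  have e2 : ((τ - (t - s) : ℤ) : ℝ) * α' + x' - h =
      (τ * α' + x' - height α x τ) - (offset α' x' t - offset α' x' s) := by
    rw [hh]
    unfold offset
    rw [hs, ht]
    push_cast
    ring
  have h1 : h ≤ height α x (τ - (t - s)) := by
    rw [le_height, e1]
    linarith
  have h2 : 0 ≤ ((τ - (t - s) : ℤ) : ℝ) * α' + x' - h := by
    rwa [hagree, le_height] at h1
  obtain ⟨h3, h4⟩ := S'.mem (by omega) (by omega) h2 (by rw [e2]; linarith)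
  have h5 := (S.iff_offset (τ - (t - s)) (by omega) (by omega)).1 h3
  unfold offset at h5
  rw [hagree, h4, e1] at h5
  refine ⟨h3, by linarith, by linarith⟩

/-- Time reversal negates the slope, which `IsStrip` allows; it reduces differences before the hits
to differences after them. -/
lemma reverse (S : IsStrip H n α x c) :
    IsStrip (fun t => H (n - t)) n (-α) (n * α + x) c := by
  refine ⟨S.width_le, fun t h0 h1 => ?_⟩
  rw [S.iff_offset (n - t) (by omega) (by omega)]
  have e : (t : ℝ) * (-α) + (n * α + x) = ((n - t : ℤ) : ℝ) * α + x := by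
    push_cast
    ring
  unfold offset height
  rw [e]

end IsStrip

lemma height_reverse (n t : ℤ) (α x : ℝ) :
    height (-α) (n * α + x) t = height α x (n - t) := by
  unfold height
  congr 1
  push_cast
  ring

lemma offset_reverse (n t : ℤ) (α x : ℝ) :
    offset (-α) (n * α + x) t = offset α x (n - t) := by
  unfold offset
  rw [height_reverse]
  push_cast
  ring

variable {H : ℤ → Prop} {n : ℤ} {α x c α' x' c' : ℝ}

lemma Consec.reverse {s t : ℤ} (h : Consec H n s t) :
    Consec (fun t => H (n - t)) n (n - t) (n - s) := by
  obtain ⟨hs0, hlt, htn, Hs, Ht, hno⟩ := h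
  refine ⟨by omega, by omega, by omega, by simpa using Ht, by simpa using Hs, fun r h1 h2 => ?_⟩
  exact hno _ (by omega) (by omega)

namespace IsStrip

lemma opposite_of_before (S : IsStrip H n α x c) (S' : IsStrip H n α' x' c') {τ : ℤ}
    (hτ : 0 ≤ τ) (hlt : height α' x' τ < height α x τ) {s t : ℤ} (hst : Consec H n s t)
    (hts : τ < s) (hH : ¬ H τ) (hs : height α x s = height α' x' s)
    (ht : height α x t = height α' x' t)
    (hagree : height α x (τ + (t - s)) = height α' x' (τ + (t - s))) :
    H (τ + (t - s)) ∧ offset α x t < offset α x s ∧ offset α' x' s < offset α' x' t := by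
  have e : n - (n - τ - (n - s - (n - t))) = τ + (t - s) := by ring
  have := opposite_of_after S.reverse S'.reverse (τ := n - τ) (by omega)
    (by simpa [height_reverse] using hlt) hst.reverse (by omega) (by simpa using hH)
    (by simpa [height_reverse] using ht) (by simpa [height_reverse] using hs)
    (by simpa only [height_reverse, e] using hagree)
  simpa only [offset_reverse, e, sub_sub_cancel] using this

end IsStrip

/-- Two strips with the same hits drift in opposite directions, and this is visible at some time
outside the range of the hits. -/
def Opposite (H : ℤ → Prop) (n : ℤ) (α x α' x' : ℝ) : Prop :=
  (∀ s t, Consec H n s t → offset α x s < offset α x t ∧ offset α' x' t < offset α' x' s) ∧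
  ∃ τ, 0 ≤ τ ∧ τ ≤ n ∧ ¬ H τ ∧
    (∀ s t, Consec H n s t → t < τ ∧ H (τ - (t - s)) ∨ τ < s ∧ H (τ + (t - s)))

/-- Between the first hit a and the last hit b, `height_le_of_consec` applied both ways gives
equality. A disagreement is thus outside [a, b]; take τ to be the nearest one on its side.
Translating τ by any gap towards the hits lands where the heights agree, and which line is higher at
τ decides which strip drifts up. -/
theorem opposite_of_height_ne (S : IsStrip H n α x c) (S' : IsStrip H n α' x' c') {a b : ℤ}
    (ha0 : 0 ≤ a) (hab : a < b) (hbn : b ≤ n) (Ha : H a) (Hb : H b)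
    (hmin : ∀ t, 0 ≤ t → t < a → ¬ H t) (hmax : ∀ t, b < t → t ≤ n → ¬ H t)
    (hag : ∀ t, a ≤ t → t ≤ b → H t → height α x t = height α' x' t) :
    (∀ t, 0 ≤ t → t ≤ n → height α x t = height α' x' t) ∨
      Opposite H n α x α' x' ∨ Opposite H n α' x' α x := by
  have prev : ∀ t, a < t → t ≤ b → ∃ s, a ≤ s ∧ s < t ∧ H s ∧ ∀ r, s < r → r < t → ¬ H r := by
    intro t h1 h2
    obtain ⟨s, ⟨hs1, hs2, hs3⟩, hs4⟩ := Int.exists_greatest_of_bdd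
      (P := fun s => a ≤ s ∧ s < t ∧ H s) ⟨t, fun z hz => hz.2.1.le⟩ ⟨a, le_rfl, h1, Ha⟩
    refine ⟨s, hs1, hs2, hs3, fun r h3 h4 h5 => ?_⟩
    have := hs4 r ⟨by omega, h4, h5⟩
    omega
  have next : ∀ t, a ≤ t → t ≤ b → ∃ s, t ≤ s ∧ s ≤ b ∧ H s ∧ ∀ r, t ≤ r → r < s → ¬ H r := by
    intro t h1 h2
    obtain ⟨s, ⟨hs1, hs2, hs3⟩, hs4⟩ := Int.exists_least_of_bdd
      (P := fun s => t ≤ s ∧ s ≤ b ∧ H s) ⟨t, fun z hz => hz.1⟩ ⟨b, h2, le_rfl, Hb⟩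
    refine ⟨s, hs1, hs2, hs3, fun r h3 h4 h5 => ?_⟩
    have := hs4 r ⟨h3, by omega, h5⟩
    omega
  have mid : ∀ t, a ≤ t → t ≤ b → height α x t = height α' x' t := by
    intro t h1 h2
    by_cases hH : H t
    · exact hag t h1 h2 hH
    · have hta : t ≠ a := fun h => hH (h ▸ Ha)
      obtain ⟨s, hs1, hs2, hs3, hs4⟩ := prev t (by omega) h2
      obtain ⟨r, hr1, hr2, hr3, hr4⟩ := next t h1 h2
      have htr : t ≠ r := fun h => hH (h ▸ hr3)
      have hc : Consec H n s r := by
        refine ⟨by omega, by omega, by omega, hs3, hr3, fun q h3 h4 => ?_⟩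
        rcases lt_or_ge q t with h | h
        · exact hs4 q h3 h
        · exact hr4 q h h4
      have e1 := hag s hs1 (by omega) hs3
      have e2 := hag r (by omega) hr2 hr3
      exact le_antisymm (S.height_le_of_consec hc e1 e2 hs2 (by omega))
        (S'.height_le_of_consec hc e1.symm e2.symm hs2 (by omega))
  have hrange : ∀ s t, Consec H n s t → a ≤ s ∧ t ≤ b := by
    intro s t ⟨h1, h2, h3, h4, h5, h6⟩
    constructor <;> by_contra! h
    · exact hmin s h1 h h4
    · exact hmax t h h3 h5
  by_cases hall : ∀ t, 0 ≤ t → t ≤ n → height α x t = height α' x' t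
  · exact .inl hall
  right
  push Not at hall
  obtain ⟨t₀, ht1, ht2, ht3⟩ := hall
  have ht4 : t₀ < a ∨ b < t₀ := by
    by_contra! h
    exact ht3 (mid t₀ h.1 h.2)
  rcases ht4 with h | h
  · obtain ⟨τ, ⟨hτ1, hτ2, hτ3⟩, hτ4⟩ := Int.exists_greatest_of_bdd
      (P := fun s => 0 ≤ s ∧ s < a ∧ height α x s ≠ height α' x' s)
      ⟨a, fun z hz => hz.2.1.le⟩ ⟨t₀, ht1, h, ht3⟩
    have hno := hmin τ hτ1 hτ2
    have agree : ∀ t, τ < t → t ≤ b → height α x t = height α' x' t := by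
      intro t h1 h2
      by_cases h3 : t < a
      · by_contra h4
        have := hτ4 t ⟨by omega, h3, h4⟩
        omega
      · exact mid t (by omega) h2
    rcases lt_or_gt_of_ne hτ3 with hl | hl
    · have key : ∀ s t, Consec H n s t → H (τ + (t - s)) ∧ offset α' x' t < offset α' x' s ∧
          offset α x s < offset α x t := by
        intro s t hst
        obtain ⟨h1, h2⟩ := hrange s t hst
        have h3 := hst.2.1
        exact S'.opposite_of_before S hτ1 hl hst (by omega) hno
          (agree s (by omega) (by omega)).symm (agree t (by omega) (by omega)).symm
          (agree _ (by omega) (by omega)).symm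
      refine .inl ⟨fun s t h => (key s t h).2.symm, τ, hτ1, by omega, hno, fun s t h => .inr ?_⟩
      exact ⟨by have := hrange s t h; omega, (key s t h).1⟩
    · have key : ∀ s t, Consec H n s t → H (τ + (t - s)) ∧ offset α x t < offset α x s ∧
          offset α' x' s < offset α' x' t := by
        intro s t hst
        obtain ⟨h1, h2⟩ := hrange s t hst
        have h3 := hst.2.1
        exact S.opposite_of_before S' hτ1 hl hst (by omega) hno
          (agree s (by omega) (by omega)) (agree t (by omega) (by omega))
          (agree _ (by omega) (by omega))
      refine .inr ⟨fun s t h => (key s t h).2.symm, τ, hτ1, by omega, hno, fun s t h => .inr ?_⟩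
      exact ⟨by have := hrange s t h; omega, (key s t h).1⟩
  · obtain ⟨τ, ⟨hτ1, hτ2, hτ3⟩, hτ4⟩ := Int.exists_least_of_bdd
      (P := fun s => b < s ∧ s ≤ n ∧ height α x s ≠ height α' x' s)
      ⟨b, fun z hz => hz.1.le⟩ ⟨t₀, h, ht2, ht3⟩
    have hno := hmax τ hτ1 hτ2
    have agree : ∀ t, a ≤ t → t < τ → height α x t = height α' x' t := by
      intro t h1 h2
      by_cases h3 : b < t
      · by_contra h4
        have := hτ4 t ⟨h3, by omega, h4⟩
        omega
      · exact mid t h1 (by omega)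
    rcases lt_or_gt_of_ne hτ3 with hl | hl
    · have key : ∀ s t, Consec H n s t → H (τ - (t - s)) ∧ offset α' x' s < offset α' x' t ∧
          offset α x t < offset α x s := by
        intro s t hst
        obtain ⟨h1, h2⟩ := hrange s t hst
        have h3 := hst.2.1
        exact S'.opposite_of_after S hτ2 hl hst (by omega) hno
          (agree s (by omega) (by omega)).symm (agree t (by omega) (by omega)).symm
          (agree _ (by omega) (by omega)).symm
      refine .inr ⟨fun s t h => (key s t h).2, τ, by omega, hτ2, hno, fun s t h => .inl ?_⟩
      exact ⟨by have := hrange s t h; omega, (key s t h).1⟩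
    · have key : ∀ s t, Consec H n s t → H (τ - (t - s)) ∧ offset α x s < offset α x t ∧
          offset α' x' t < offset α' x' s := by
        intro s t hst
        obtain ⟨h1, h2⟩ := hrange s t hst
        have h3 := hst.2.1
        exact S.opposite_of_after S' hτ2 hl hst (by omega) hno
          (agree s (by omega) (by omega)) (agree t (by omega) (by omega))
          (agree _ (by omega) (by omega))
      refine .inl ⟨fun s t h => (key s t h).2, τ, by omega, hτ2, hno, fun s t h => .inl ?_⟩
      exact ⟨by have := hrange s t h; omega, (key s t h).1⟩

end RotWord
-- Equal gaps, or equal height increments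
namespace RotWord

variable {H : ℤ → Prop} {n : ℤ} {α x c α' x' c' : ℝ}

lemma Consec.exists_prev {a t : ℤ} (ha : 0 ≤ a) (h : a < t) (htn : t ≤ n) (Ha : H a) (Ht : H t) :
    ∃ s, a ≤ s ∧ Consec H n s t := by
  obtain ⟨s, ⟨hs1, hs2, hs3⟩, hs4⟩ := Int.exists_greatest_of_bdd
    (P := fun s => a ≤ s ∧ s < t ∧ H s) ⟨t, fun z hz => hz.2.1.le⟩ ⟨a, le_rfl, h, Ha⟩
  refine ⟨s, hs1, by omega, hs2, htn, hs3, Ht, fun r h3 h4 h5 => ?_⟩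
  have := hs4 r ⟨by omega, h4, h5⟩
  omega

lemma Consec.exists_next {b t : ℤ} (ht : 0 ≤ t) (h : t < b) (hbn : b ≤ n) (Hb : H b) (Ht : H t) :
    ∃ s, s ≤ b ∧ Consec H n t s := by
  obtain ⟨s, ⟨hs1, hs2, hs3⟩, hs4⟩ := Int.exists_least_of_bdd
    (P := fun s => t < s ∧ s ≤ b ∧ H s) ⟨t, fun z hz => hz.1.le⟩ ⟨b, h, le_rfl, Hb⟩
  refine ⟨s, hs2, ht, hs1, by omega, Ht, hs3, fun r h3 h4 h5 => ?_⟩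
  have := hs4 r ⟨h3, by omega, h5⟩
  omega

/-- Consecutive pairs form a single chain, so a property that passes between neighbours in both
directions holds for all pairs or for none. -/
lemma Consec.iff_of_adjacent {P : ℤ → ℤ → Prop}
    (hP : ∀ s t r, Consec H n s t → Consec H n t r → (P s t ↔ P t r)) {s t s' t' : ℤ}
    (h : Consec H n s t) (h' : Consec H n s' t') : P s t ↔ P s' t' := by
  have key : ∀ (m : ℕ) (s t s' t' : ℤ), Consec H n s t → Consec H n s' t' → t ≤ t' → t' ≤ t + m →
      (P s t ↔ P s' t') := by
    intro m
    induction m with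
    | zero =>
      intro s t s' t' h h' h1 h2
      obtain rfl : t = t' := by push_cast at h2; omega
      obtain ⟨a1, a2, a3, a4, a5, a6⟩ := h
      obtain ⟨b1, b2, b3, b4, b5, b6⟩ := h'
      obtain rfl : s = s' := by
        rcases lt_trichotomy s s' with h | h | h
        · exact absurd b4 (a6 _ h b2)
        · exact h
        · exact absurd a4 (b6 _ h a2)
      rfl
    | succ m ih =>
      intro s t s' t' h h' h1 h2
      by_cases h3 : t' ≤ t + m
      · exact ih s t s' t' h h' h1 h3
      · push_cast at h2
        have hs : t ≤ s' := by
          by_contra! h4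
          exact h'.2.2.2.2.2 t h4 (by omega) h.2.2.2.2.1
        obtain ⟨r, hr, hc⟩ := Consec.exists_prev (n := n) h.1 (show s < s' by have := h.2.1; omega)
          (by have := h'.2.1; have := h'.2.2.1; omega) h.2.2.2.1 h'.2.2.2.1
        rw [← hP r s' t' hc h']
        exact ih s t r s' h hc hs (by have := h'.2.1; omega)
  rcases le_total t t' with hl | hl
  · exact key (t' - t).toNat s t s' t' h h' hl (by omega)
  · exact (key (t - t').toNat s' t' s t h' h hl (by omega)).symm

/-- If all gaps between consecutive elements of `H` are equal, then `H` is an arithmetic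
progression. -/
lemma exists_progression {a b : ℤ} (ha : 0 ≤ a) (hab : a < b) (hbn : b ≤ n) (Ha : H a) (Hb : H b)
    (hmin : ∀ t, 0 ≤ t → t < a → ¬ H t) (hmax : ∀ t, b < t → t ≤ n → ¬ H t)
    (hgap : ∀ s t r, Consec H n s t → Consec H n t r → t - s = r - t) :
    ∃ d k : ℤ, 1 ≤ d ∧ 1 ≤ k ∧ b = a + k * d ∧ (∀ s t, Consec H n s t → t - s = d) ∧
      ∀ t, 0 ≤ t → t ≤ n → (H t ↔ ∃ m, 0 ≤ m ∧ m ≤ k ∧ t = a + m * d) := by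
  obtain ⟨t₁, ht₁b, hc⟩ := Consec.exists_next ha hab hbn Hb Ha
  set d := t₁ - a with hd
  have hd1 : 1 ≤ d := by have := hc.2.1; omega
  have hall : ∀ s t, Consec H n s t → t - s = d := by
    intro s t hst
    refine (Consec.iff_of_adjacent (P := fun s t => t - s = d) ?_ hc hst).1 rfl
    intro s t r h1 h2
    rw [hgap s t r h1 h2]
  have hdvd : ∀ m : ℕ, ∀ t, a ≤ t → t ≤ a + m → t ≤ n → H t → d ∣ t - a := by
    intro m
    induction m with
    | zero =>
      intro t h1 h2 _ _
      have : t - a = 0 := by push_cast at h2; omega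
      simp [this]
    | succ m ih =>
      intro t h1 h2 h3 h4
      rcases eq_or_lt_of_le h1 with h | h
      · simp [← h]
      · obtain ⟨s, hs, hc'⟩ := Consec.exists_prev ha h h3 Ha h4
        have e := hall s t hc'
        push_cast at h2
        have := ih s hs (by omega) (by omega) hc'.2.2.2.1
        have e2 : t - a = (s - a) + d := by omega
        rw [e2]
        exact dvd_add this dvd_rfl
  have hdvd' : ∀ t, 0 ≤ t → t ≤ n → H t → ∃ m, 0 ≤ m ∧ t = a + m * d := by
    intro t h1 h2 h3
    have hat : a ≤ t := by
      by_contra! h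
      exact hmin t h1 h h3
    obtain ⟨m, hm⟩ := hdvd (t - a).toNat t hat (by omega) h2 h3
    refine ⟨m, by nlinarith, ?_⟩
    rw [mul_comm] at hm
    omega
  obtain ⟨k, hk0, hk⟩ := hdvd' b (by omega) hbn Hb
  refine ⟨d, k, hd1, by nlinarith, hk, hall, fun t ht htn => ⟨fun hH => ?_, ?_⟩⟩
  · obtain ⟨m, hm0, hm⟩ := hdvd' t ht htn hH
    refine ⟨m, hm0, ?_, hm⟩
    by_contra! h
    refine hmax t ?_ htn hH
    nlinarith
  · rintro ⟨m, hm0, hmk, rfl⟩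
    lift m to ℕ using hm0
    clear ht htn
    induction m with
    | zero => simpa using Ha
    | succ m ih =>
      push_cast at hmk ⊢
      have hH := ih (by omega)
      have hl : a + m * d < b := by rw [hk]; nlinarith
      have hl0 : 0 ≤ a + m * d := by positivity
      obtain ⟨s, hs, hc'⟩ := Consec.exists_next hl0 hl hbn Hb hH
      have e := hall _ _ hc'
      have : a + (m + 1) * d = s := by linarith
      rw [this]
      exact hc'.2.2.2.2.1

/-- Determinant ±1 fixes the numerators modulo the coprime denominators up to a common sign.
Numerators in the lower half remove the ambiguity: p ≡ -q modulo d is possible only if p = q = d/2.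
-/
lemma eq_of_two_mul_le {d d' p p' q q' : ℤ} (hp : 1 ≤ p) (hp' : 1 ≤ p')
    (hq : 1 ≤ q) (hq' : 1 ≤ q') (hpd : 2 * p ≤ d) (hpd' : 2 * p' ≤ d') (hqd : 2 * q ≤ d)
    (hqd' : 2 * q' ≤ d') (h1 : |d * p' - p * d'| = 1) (h2 : |d * q' - q * d'| = 1) :
    p = q ∧ p' = q' := by
  have hcop : IsCoprime d d' := by
    rcases abs_eq (by norm_num : (0 : ℤ) ≤ 1) |>.1 h1 with h | h
    · exact ⟨p', -p, by linarith⟩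
    · exact ⟨-p', p, by linarith⟩
  have same : d * (p' - q') = (p - q) * d' → p = q ∧ p' = q' := by
    intro h
    have hdvd : d ∣ p - q := hcop.dvd_of_dvd_mul_right ⟨_, h.symm⟩
    have h0 : p - q = 0 := Int.eq_zero_of_abs_lt_dvd hdvd (by rw [abs_lt]; constructor <;> omega)
    rw [h0, zero_mul] at h
    rcases mul_eq_zero.1 h with h | h <;> constructor <;> omega
  have opp : d * (p' + q') = (p + q) * d' → p = q ∧ p' = q' := by
    intro h
    have hdvd : d ∣ p + q := hcop.dvd_of_dvd_mul_right ⟨_, h.symm⟩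
    have hle := Int.le_of_dvd (by omega) hdvd
    have hdvd' : d' ∣ p' + q' := hcop.symm.dvd_of_dvd_mul_left ⟨p + q, by linarith⟩
    have hle' := Int.le_of_dvd (by omega) hdvd'
    constructor <;> omega
  rcases abs_eq (by norm_num : (0 : ℤ) ≤ 1) |>.1 h1 with h | h <;>
    rcases abs_eq (by norm_num : (0 : ℤ) ≤ 1) |>.1 h2 with h' | h'
  · exact same (by linarith)
  · exact opp (by linarith)
  · exact opp (by linarith)
  · exact same (by linarith)

namespace IsStrip

/-- With determinant 0, the two gap vectors are parallel and primitive with positive first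
coordinates, so they coincide. -/
lemma cross_eq_one_or (S : IsStrip H n α x c) {s t r : ℤ} (hst : Consec H n s t)
    (htr : Consec H n t r) : t - s = r - t ∨
    |(t - s) * (height α x r - height α x t) - (height α x t - height α x s) * (r - t)| = 1 := by
  have h := S.abs_cross_le_one hst htr
  have h1 := S.isCoprime hst
  have h2 := S.isCoprime htr
  have hd := hst.2.1
  have hd' := htr.2.1
  set p := height α x t - height α x s
  set p' := height α x r - height α x t
  rcases eq_or_ne ((t - s) * p' - p * (r - t)) 0 with h0 | h0
  · left
    have e : (t - s) * p' = p * (r - t) := by linarith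
    exact Int.dvd_antisymm (by omega) (by omega) (h1.dvd_of_dvd_mul_left ⟨p', e.symm⟩)
      (h2.dvd_of_dvd_mul_right ⟨p, by linarith⟩)
  · right
    have := abs_pos.2 h0
    omega

lemma height_sub_eq_of_gap_eq (S : IsStrip H n α x c) {s t r : ℤ} (hst : Consec H n s t)
    (htr : Consec H n t r) (h2 : 2 ≤ t - s) (h : t - s = r - t) :
    height α x t - height α x s = height α x r - height α x t := by
  have h1 := S.abs_cross_le_one hst htr
  rw [← h] at h1
  set p := height α x t - height α x s
  set p' := height α x r - height α x t
  have e : (t - s) * p' - p * (t - s) = (t - s) * (p' - p) := by ring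
  rw [e, abs_mul, abs_of_pos (by omega)] at h1
  have : |p' - p| < 1 := by
    by_contra! h3
    nlinarith
  rw [Int.abs_lt_one_iff] at this
  omega

end IsStrip

lemma offset_add_int (α x : ℝ) (m t : ℤ) : offset α (x + m) t = offset α x t := by
  unfold offset height
  rw [← add_assoc, Int.floor_add_intCast]
  push_cast
  ring

lemma height_add_int (α x : ℝ) (m t : ℤ) : height α (x + m) t = height α x t + m := by
  unfold height
  rw [← add_assoc, Int.floor_add_intCast]

lemma IsStrip.add_int (S : IsStrip H n α x c) (m : ℤ) : IsStrip H n α (x + m) c :=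
  ⟨S.width_le, by simpa only [offset_add_int] using S.iff_offset⟩

/-- Two strips with the same isolated hits have the same increments of the height between
consecutive hits, unless all gaps are equal. -/
theorem height_sub_eq_or_gaps_eq (S : IsStrip H n α x c) (S' : IsStrip H n α' x' c')
    (hα₀ : 0 ≤ α) (hα : α < 1 / 2) (hα₀' : 0 ≤ α') (hα' : α' < 1 / 2)
    (h2 : ∀ s t, Consec H n s t → 2 ≤ t - s) :
    (∀ s t, Consec H n s t →
      height α x t - height α x s = height α' x' t - height α' x' s) ∨
    ∀ s t r, Consec H n s t → Consec H n t r → t - s = r - t := by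
  have adj : ∀ s t r, Consec H n s t → Consec H n t r → t - s ≠ r - t →
      height α x t - height α x s = height α' x' t - height α' x' s ∧
      height α x r - height α x t = height α' x' r - height α' x' t := by
    intro s t r h h' hne
    obtain ⟨a1, a2⟩ := S.two_mul_le hα₀ hα h (h2 _ _ h)
    obtain ⟨a3, a4⟩ := S.two_mul_le hα₀ hα h' (h2 _ _ h')
    obtain ⟨b1, b2⟩ := S'.two_mul_le hα₀' hα' h (h2 _ _ h)
    obtain ⟨b3, b4⟩ := S'.two_mul_le hα₀' hα' h' (h2 _ _ h')
    exact eq_of_two_mul_le a1 a3 b1 b3 a2 a4 b2 b4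
      ((S.cross_eq_one_or h h').resolve_left hne) ((S'.cross_eq_one_or h h').resolve_left hne)
  by_contra! hcon
  obtain ⟨⟨s₀, t₀, h₀, hne₀⟩, s, t, r, h, h', hne⟩ := hcon
  refine hne₀ ((Consec.iff_of_adjacent (P := fun s t =>
    height α x t - height α x s = height α' x' t - height α' x' s) ?_ h h₀).1 (adj s t r h h' hne).1)
  intro s t r h h'
  by_cases hd : t - s = r - t
  · rw [S.height_sub_eq_of_gap_eq h h' (h2 _ _ h) hd, S'.height_sub_eq_of_gap_eq h h' (h2 _ _ h) hd]
  · exact iff_of_true (adj s t r h h' hd).1 (adj s t r h h' hd).2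

lemma Opposite.gaps_eq (S : IsStrip H n α x c) (h : Opposite H n α x α' x') (s t r : ℤ)
    (hst : Consec H n s t) (htr : Consec H n t r) : t - s = r - t :=
  S.gap_eq hst htr (.inl ⟨(h.1 s t hst).1, (h.1 t r htr).1⟩)

theorem opposite_of_height_sub_eq (S : IsStrip H n α x c) (S' : IsStrip H n α' x' c') {a b : ℤ}
    (ha0 : 0 ≤ a) (hab : a < b) (hbn : b ≤ n) (Ha : H a) (Hb : H b)
    (hmin : ∀ t, 0 ≤ t → t < a → ¬ H t) (hmax : ∀ t, b < t → t ≤ n → ¬ H t)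
    (hag : ∀ s t, Consec H n s t →
      height α x t - height α x s = height α' x' t - height α' x' s) :
    (∀ t, 0 ≤ t → t ≤ n →
      height α x t - height α x a = height α' x' t - height α' x' a) ∨
      Opposite H n α x α' x' ∨ Opposite H n α' x' α x := by
  -- Shifting the second line by the integer D makes the heights agree at the first hit without
  -- changing any offset.
  set D := height α x a - height α' x' a with hD
  have hag' : ∀ (m : ℕ) (t : ℤ), a ≤ t → t ≤ a + m → t ≤ b → H t →
      height α x t = height α' (x' + D) t := by
    intro m
    induction m with
    | zero =>
      intro t h1 h2 _ _
      obtain rfl : a = t := by push_cast at h2; omega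
      rw [height_add_int]
      omega
    | succ m ih =>
      intro t h1 h2 h3 h4
      rcases eq_or_lt_of_le h1 with rfl | h
      · rw [height_add_int]
        omega
      · obtain ⟨s, hs, hc⟩ := Consec.exists_prev ha0 h (h3.trans hbn) Ha h4
        have hlt := hc.2.1
        push_cast at h2
        have e := ih s hs (by omega) (by omega) hc.2.2.2.1
        have e' := hag s t hc
        rw [height_add_int] at e ⊢
        omega
  have key := opposite_of_height_ne S (S'.add_int D) ha0 hab hbn Ha Hb hmin hmax
    (fun t h1 h2 h3 => hag' (t - a).toNat t h1 (by omega) h2 h3)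
  simp only [Opposite, offset_add_int, height_add_int] at key ⊢
  refine key.imp_left fun h t h0 h1 => ?_
  have := h t h0 h1
  omega

end RotWord
-- Generating pairs as strips
namespace RotWord

lemma val_eq_ite (a : Fin 2) : (a.val : ℤ) = if a = 1 then 1 else 0 := by
  revert a
  decide

/-- The difference of floors is 1 exactly when the fractional part of iα is in the arc of length α
starting at β; the two cases are whether this arc passes through 0 on the circle. -/
lemma letter_val {α β : ℝ} (hα : α ∈ Set.Ioo (0 : ℝ) 1) (hβ : β ∈ Set.Ico (0 : ℝ) 1) (i : ℕ) :
    ((letter α β (Int.fract (β + α)) i).val : ℤ) = ⌊i * α - β⌋ - ⌊i * α - β - α⌋ := by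
  obtain ⟨hα0, hα1⟩ := hα
  obtain ⟨hβ0, hβ1⟩ := hβ
  have hy0 := Int.fract_nonneg (i * α)
  have hy1 := Int.fract_lt_one (i * α)
  have hy := Int.floor_add_fract (i * α)
  set y := Int.fract (i * α) with hydef
  set N := ⌊i * α⌋
  have e1 : i * α - β = (N : ℝ) + (y - β) := by linarith
  have e2 : i * α - β - α = (N : ℝ) + (y - β - α) := by linarith
  rw [e2, e1, Int.floor_intCast_add, Int.floor_intCast_add, val_eq_ite]
  have hl : letter α β (Int.fract (β + α)) i = 1 ↔ y ∈ arc β (Int.fract (β + α)) := by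
    unfold letter
    rw [← hydef]
    split_ifs with h <;> simp [h]
  have f0 : ⌊y - β⌋ = if β ≤ y then 0 else -1 := by
    split_ifs with h
    · rw [Int.floor_eq_iff]; push_cast; constructor <;> linarith
    · rw [Int.floor_eq_iff]; push_cast; constructor <;> linarith
  classical
  rw [if_congr hl rfl rfl]
  rcases lt_or_ge (β + α) 1 with h | h
  · have hf : Int.fract (β + α) = β + α := Int.fract_eq_self.2 ⟨by linarith, h⟩
    have f1 : ⌊y - β - α⌋ = if β + α ≤ y then 0 else -1 := by
      split_ifs with h
      · rw [Int.floor_eq_iff]; push_cast; constructor <;> linarith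
      · rw [Int.floor_eq_iff]; push_cast; constructor <;> linarith
    rw [hf, f0, f1, arc, if_pos (show β < β + α by linarith), Set.mem_Ico]
    by_cases h1 : β ≤ y <;> by_cases h2 : β + α ≤ y
    · simp [h1, h2]
    · simp [h1, h2]
    · linarith
    · simp [h1, h2]
  · have hf : Int.fract (β + α) = β + α - 1 := by
      rw [Int.fract_eq_iff]
      exact ⟨by linarith, by linarith, 1, by push_cast; ring⟩
    have f1 : ⌊y - β - α⌋ = if β + α - 1 ≤ y then -1 else -2 := by
      split_ifs with h
      · rw [Int.floor_eq_iff]; push_cast; constructor <;> linarith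
      · rw [Int.floor_eq_iff]; push_cast; constructor <;> linarith
    rw [hf, f0, f1, arc, if_neg (show ¬ β < β + α - 1 by linarith), Set.mem_union, Set.mem_Ico, Set.mem_Ico]
    by_cases h1 : β ≤ y <;> by_cases h2 : β + α - 1 ≤ y
    · simp [h1, h2, hy1]
    · linarith
    · simp [h1, h2]
    · simp [h1, h2, hy0]

/-- The Sturmian words are the words of increments of the heights of lines. -/
lemma mem_sturmian_iff {α : ℝ} (hα : α ∈ Set.Ioo (0 : ℝ) 1) {n : ℕ} {u : Word} :
    u ∈ Sturmian n α ↔ u.length = n ∧ ∃ x : ℝ, ∀ k < n,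
      ((u.getD k 0).val : ℤ) = height α x (k + 1) - height α x k := by
  have hval : ∀ β ∈ Set.Ico (0 : ℝ) 1, ∀ k : ℕ, ((letter α β (Int.fract (β + α)) k).val : ℤ) =
      height α (-α - β) (k + 1) - height α (-α - β) k := by
    intro β hβ k
    rw [letter_val hα hβ]
    unfold height
    congr 2 <;> push_cast <;> ring
  constructor
  · rintro ⟨β, hβ, rfl⟩
    refine ⟨by simp [rot], -α - β, fun k hk => ?_⟩
    rw [← hval β hβ]
    simp [rot, hk]
  · rintro ⟨hlen, x, hx⟩
    refine ⟨Int.fract (-α - x), ⟨Int.fract_nonneg _, Int.fract_lt_one _⟩, ?_⟩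
    have hx' : -α - Int.fract (-α - x) = x + (⌊-α - x⌋ : ℤ) := by
      have := Int.floor_add_fract (-α - x)
      linarith
    refine List.ext_getElem (by simp [rot, hlen]) fun k h1 h2 => ?_
    have h3 := hx k (by omega)
    have h4 := hval (Int.fract (-α - x)) ⟨Int.fract_nonneg _, Int.fract_lt_one _⟩ k
    rw [hx', height_add_int, height_add_int] at h4
    rw [List.getD_eq_getElem _ _ h1] at h3
    simp only [rot, List.getElem_ofFn]
    ext
    omega

/-- The positions of the letter `1` in `w`. -/
def Ones (w : Word) (t : ℤ) : Prop := w.getD t.toNat 0 = 1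

/-- The pair `(u, v)` generates `w` along the strip of vertical width `c` below the line
`t ↦ t α + x`. -/
structure IsRep (w u v : Word) (α x c : ℝ) : Prop where
  slope_pos : 0 < α
  slope_lt : α < 1 / 2
  width_pos : 0 < c
  strip : IsStrip (Ones w) (w.length - 1) α x c
  length_left : w.length = u.length + 1
  length_right : v.length = u.length
  left_eq : ∀ k < u.length, ((u.getD k 0).val : ℤ) = height α x (k + 1) - height α x k
  right_eq : ∀ k < u.length,
    ((v.getD k 0).val : ℤ) = height α (x - c) (k + 1) - height α (x - c) k

lemma floor_sub_eq_ite {y c : ℝ} (hc0 : 0 ≤ c) (hc1 : c ≤ 1) :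
    ⌊y⌋ - ⌊y - c⌋ = if y - ⌊y⌋ < c then 1 else 0 := by
  have h1 := Int.floor_le y
  have h2 := Int.lt_floor_add_one y
  split_ifs with h
  · have : ⌊y - c⌋ = ⌊y⌋ - 1 := by
      rw [Int.floor_eq_iff]; push_cast; constructor <;> linarith
    omega
  · have : ⌊y - c⌋ = ⌊y⌋ := by
      rw [Int.floor_eq_iff]; constructor <;> linarith
    omega

lemma IsRep.val_eq {w u v : Word} {α x c : ℝ} (h : IsRep w u v α x c) {k : ℕ}
    (hk : k < w.length) :
    ((w.getD k 0).val : ℤ) = height α x k - height α (x - c) k := by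
  have h1 := floor_sub_eq_ite (y := k * α + x) h.width_pos.le h.strip.width_le
  have h2 := h.strip.iff_offset k (by omega) (by omega)
  unfold offset height Ones at h2
  simp only [Int.toNat_natCast, Int.cast_natCast] at h2
  unfold height
  simp only [Int.cast_natCast]
  rw [← add_sub_assoc, h1, val_eq_ite, if_congr h2 rfl rfl]

lemma IsRep.recurrence {w u v : Word} {α x c : ℝ} (h : IsRep w u v α x c) : Recurrence u v w := by
  refine ⟨h.length_left, h.length_right, fun k hk => ?_⟩
  have := h.length_left
  have h1 := h.val_eq (k := k) (by omega)
  have h2 := h.val_eq (k := k + 1) (by omega)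
  have h3 := h.left_eq k hk
  have h4 := h.right_eq k hk
  push_cast at h2
  omega

/-- Summing the recurrence makes `w` the difference of the heights of two parallel lines. A letter 0
shows that their vertical distance is less than 1, and a letter 1 that it is positive. -/
lemma mem_generatingPairs_iff {w u v : Word} (h0 : 0 ∈ w) (h1 : 1 ∈ w) :
    (u, v) ∈ generatingPairs w ↔ ∃ α x c, IsRep w u v α x c := by
  constructor
  · rintro ⟨α, hα, hu, hv, hlen, hlen', hrec⟩
    have hα' : α ∈ Set.Ioo (0 : ℝ) 1 := ⟨hα.1, hα.2.trans (by norm_num)⟩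
    rw [mem_sturmian_iff hα'] at hu hv
    obtain ⟨-, a, ha⟩ := hu
    obtain ⟨-, b, hb⟩ := hv
    dsimp only at hlen hlen' hrec ha hb
    -- Increments determine heights only up to an integer; this shift matches the first letter of
    -- `w`.
    set m : ℤ := ((w.getD 0 0).val : ℤ) - height α a 0 + height α b 0 with hm
    have hw : ∀ k < w.length, ((w.getD k 0).val : ℤ) = height α (a + m) k - height α b k := by
      intro k
      induction k with
      | zero =>
        intro _
        rw [height_add_int]
        push_cast
        omega
      | succ k ih =>
        intro hk
        have e1 := ih (by omega)
        have e2 := hrec k (by omega)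
        have e3 := ha k (by omega)
        have e4 := hb k (by omega)
        rw [height_add_int] at e1 ⊢
        push_cast
        omega
    set x := a + m with hx
    set c := x - b with hc
    have hxc : x - c = b := by rw [hc]; ring
    have hc1 : c < 1 := by
      obtain ⟨k, hk, h⟩ := List.getElem_of_mem h0
      have e := hw k hk
      rw [List.getD_eq_getElem _ _ hk, h] at e
      unfold height at e
      have e' : ⌊(k : ℤ) * α + x⌋ = ⌊(k : ℤ) * α + b⌋ := by
        simp only [Fin.val_zero] at e
        omega
      have h2 := Int.lt_floor_add_one ((k : ℤ) * α + x)
      have h3 := Int.floor_le ((k : ℤ) * α + b)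
      rw [e'] at h2
      linarith
    have hc0 : 0 < c := by
      obtain ⟨k, hk, h⟩ := List.getElem_of_mem h1
      have e := hw k hk
      rw [List.getD_eq_getElem _ _ hk, h] at e
      unfold height at e
      have e' : ⌊(k : ℤ) * α + x⌋ = ⌊(k : ℤ) * α + b⌋ + 1 := by
        simp only [Fin.val_one] at e
        omega
      have h2 := Int.floor_le ((k : ℤ) * α + x)
      have h3 := Int.lt_floor_add_one ((k : ℤ) * α + b)
      rw [e'] at h2
      push_cast at h2
      push_cast at h3
      linarith
    refine ⟨α, x, c, hα.1, hα.2, hc0, ⟨hc1.le, fun t ht htn => ?_⟩, hlen, hlen',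
      fun k hk => ?_, fun k hk => ?_⟩
    · lift t to ℕ using ht
      have e := hw t (by omega)
      have e2 := floor_sub_eq_ite (y := t * α + x) hc0.le hc1.le
      rw [← hxc] at e
      unfold height at e
      simp only [Int.cast_natCast] at e
      rw [← add_sub_assoc, e2, val_eq_ite] at e
      unfold Ones offset height
      simp only [Int.toNat_natCast, Int.cast_natCast]
      split_ifs at e <;> simp_all
    · rw [ha k (by omega), hx, height_add_int, height_add_int]
      ring
    · rw [hb k (by omega), hxc]
  · rintro ⟨α, x, c, h⟩
    have hα' : α ∈ Set.Ioo (0 : ℝ) 1 := ⟨h.slope_pos, h.slope_lt.trans (by norm_num)⟩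
    have e : w.length - 1 = u.length := by have := h.length_left; omega
    refine ⟨α, ⟨h.slope_pos, h.slope_lt⟩, ?_, ?_, h.recurrence⟩
    · rw [mem_sturmian_iff hα']
      exact ⟨e.symm, x, by rw [e]; exact h.left_eq⟩
    · rw [mem_sturmian_iff hα']
      exact ⟨h.length_right.trans e.symm, x - c, by rw [e]; exact h.right_eq⟩

lemma ext_of_getD {u u' : Word} (hl : u.length = u'.length)
    (h : ∀ k < u.length, ((u.getD k 0).val : ℤ) = ((u'.getD k 0).val : ℤ)) : u = u' := by
  refine List.ext_getElem hl fun k h1 h2 => ?_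
  have := h k h1
  rw [List.getD_eq_getElem _ _ h1, List.getD_eq_getElem _ _ h2] at this
  ext
  omega

lemma Recurrence.right_eq {w u v v' : Word} (h : Recurrence u v w) (h' : Recurrence u v' w) :
    v = v' := by
  refine ext_of_getD (h.2.1.trans h'.2.1.symm) fun k hk => ?_
  rw [h.2.1] at hk
  have e1 := h.2.2 k hk
  have e2 := h'.2.2 k hk
  omega

namespace IsRep
variable {w u v u' v' : Word} {α x c α' x' c' : ℝ}

lemma pair_eq_of_left (h : IsRep w u v α x c) (h' : IsRep w u' v' α' x' c') (hu : u = u') :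
    (u, v) = (u', v') := by
  subst hu
  rw [h.recurrence.right_eq h'.recurrence]

lemma pair_eq (h : IsRep w u v α x c) (h' : IsRep w u' v' α' x' c') {a : ℤ}
    (hag : ∀ t : ℤ, 0 ≤ t → t ≤ w.length - 1 →
      height α x t - height α x a = height α' x' t - height α' x' a) : (u, v) = (u', v') := by
  refine h.pair_eq_of_left h' ?_
  have e1 := h.length_left
  have e2 := h'.length_left
  refine ext_of_getD (by omega) fun k hk => ?_
  rw [h.left_eq k hk, h'.left_eq k (by omega)]
  have := hag k (by omega) (by omega)
  have := hag (k + 1) (by omega) (by omega)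
  omega

lemma height_sub_eq (h : IsRep w u v α x c) (h' : IsRep w u v' α' x' c') {s t : ℤ}
    (hs : 0 ≤ s) (hsn : s ≤ w.length - 1) (ht : 0 ≤ t) (htn : t ≤ w.length - 1) :
    height α x t - height α x s = height α' x' t - height α' x' s := by
  have key : ∀ k : ℕ, k ≤ u.length →
      height α x k - height α x 0 = height α' x' k - height α' x' 0 := by
    intro k
    induction k with
    | zero =>
      intro _
      simp
    | succ k ih =>
      intro hk
      have e1 := ih (by omega)
      have e2 := h.left_eq k (by omega)
      have e3 := h'.left_eq k (by omega)
      push_cast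
      omega
  have hl := h.length_left
  lift s to ℕ using hs
  lift t to ℕ using ht
  have e1 := key s (by omega)
  have e2 := key t (by omega)
  omega

lemma exists_of_isStrip {n : ℕ} (hw : w.length = n + 1) (h0 : 0 < α) (h2 : α < 1 / 2) (hc : 0 < c)
    (S : IsStrip (Ones w) n α x c) : ∃ u v, IsRep w u v α x c := by
  have hval : ∀ y : ℝ, ∃ u : Word, u.length = n ∧ ∀ k < n,
      ((u.getD k 0).val : ℤ) = height α y (k + 1) - height α y k := by
    intro y
    have hinc : ∀ k : ℕ, height α y k ≤ height α y (k + 1) ∧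
        height α y (k + 1) ≤ height α y k + 1 := by
      intro k
      have h1 := Int.floor_le (k * α + y)
      have h2 := Int.lt_floor_add_one (k * α + y)
      unfold height
      push_cast
      constructor
      · exact Int.floor_mono (by linarith)
      · rw [← Int.lt_add_one_iff, Int.floor_lt]
        push_cast
        linarith
    refine ⟨List.ofFn fun k : Fin n => if height α y (k + 1) = height α y k then 0 else 1,
      by simp, fun k hk => ?_⟩
    rw [List.getD_eq_getElem _ _ (by simpa using hk), List.getElem_ofFn]
    have := hinc k
    split_ifs with h
    · simp [h]
    · simp only [Fin.val_one]
      dsimp only at h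
      omega
  obtain ⟨u, hu, hu'⟩ := hval x
  obtain ⟨v, hv, hv'⟩ := hval (x - c)
  refine ⟨u, v, h0, h2, hc, ?_, by omega, by omega, by rwa [hu], by rwa [hu]⟩
  rw [hw]
  simpa using S

/-- A word in which both `00` and `11` occur has at most one generating pair: the ones of `u` are
the positions of the factors `01`. -/
lemma pair_eq_of_factors (h : IsRep w u v α x c) (h' : IsRep w u' v' α' x' c')
    (h11 : ∃ t : ℤ, 0 ≤ t ∧ t + 1 ≤ w.length - 1 ∧ Ones w t ∧ Ones w (t + 1))
    (h00 : ∃ t : ℤ, 0 ≤ t ∧ t + 1 ≤ w.length - 1 ∧ ¬ Ones w t ∧ ¬ Ones w (t + 1)) :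
    (u, v) = (u', v') := by
  obtain ⟨t, ht0, htn, ht1, ht2⟩ := h11
  obtain ⟨r, hr0, hrn, hr1, hr2⟩ := h00
  have key : ∀ {u v α x c}, IsRep w u v α x c → ∀ k : ℤ, 0 ≤ k → k + 1 ≤ w.length - 1 →
      (height α x (k + 1) - height α x k = 1 ↔ ¬ Ones w k ∧ Ones w (k + 1)) ∧
      (height α x (k + 1) - height α x k = 0 ∨ height α x (k + 1) - height α x k = 1) := by
    intro u v α x c h
    have step : ∀ k, height α x (k + 1) - height α x k = 0 ∧
        offset α x (k + 1) = offset α x k + α ∨ height α x (k + 1) - height α x k = 1 ∧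
        offset α x (k + 1) = offset α x k + α - 1 := by
      intro k
      have e : offset α x (k + 1) =
          offset α x k + α - ((height α x (k + 1) - height α x k : ℤ) : ℝ) := by
        unfold offset
        push_cast
        ring
      have o1 := offset_nonneg α x k
      have o2 := offset_lt_one α x k
      have o3 := offset_nonneg α x (k + 1)
      have o4 := offset_lt_one α x (k + 1)
      have p1 := h.slope_pos
      have p2 := h.slope_lt
      set D := height α x (k + 1) - height α x k
      have d1 : (-1 : ℝ) < D := by linarith
      have d2 : (D : ℝ) < 2 := by linarith
      have d1' : -1 < D := by exact_mod_cast d1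
      have d2' : D < 2 := by exact_mod_cast d2
      obtain hD | hD : D = 0 ∨ D = 1 := by omega
      · left
        rw [e, hD]
        simp
      · right
        rw [e, hD]
        simp
    have a1 := (h.strip.iff_offset t ht0 (by omega)).1 ht1
    have a2 := (h.strip.iff_offset (t + 1) (by omega) htn).1 ht2
    have b1 := (h.strip.iff_offset r hr0 (by omega)).not.1 hr1
    have b2 := (h.strip.iff_offset (r + 1) (by omega) hrn).not.1 hr2
    have p1 := h.slope_pos
    have p2 := h.slope_lt
    -- Between adjacent times the offset moves by α or by α - 1, both of absolute value at least α.
    -- Two offsets in [0, c) thus give α < c, and two in [c, 1) give α < 1 - c. Then every wrap of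
    -- the offset goes from a letter 0 to a letter 1.
    have hc : α < c := by
      rcases step t with ⟨-, e⟩ | ⟨-, e⟩
      · linarith [offset_nonneg α x t]
      · linarith [offset_nonneg α x (t + 1)]
    have hc' : α < 1 - c := by
      rcases step r with ⟨-, e⟩ | ⟨-, e⟩
      · linarith [offset_lt_one α x (r + 1)]
      · linarith [offset_lt_one α x r]
    intro k hk hkn
    have i1 := h.strip.iff_offset k hk (by omega)
    have i2 := h.strip.iff_offset (k + 1) (by omega) hkn
    rw [i1, i2]
    have o1 := offset_nonneg α x k
    have o2 := offset_lt_one α x k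
    have o3 := offset_nonneg α x (k + 1)
    have o4 := offset_lt_one α x (k + 1)
    rcases step k with ⟨e, e'⟩ | ⟨e, e'⟩
    · refine ⟨iff_of_false (by omega) ?_, .inl e⟩
      rintro ⟨q1, q2⟩
      linarith
    · refine ⟨iff_of_true e ⟨?_, ?_⟩, .inr e⟩
      · linarith
      · linarith
  refine h.pair_eq_of_left h' ?_
  have e1 := h.length_left
  have e2 := h'.length_left
  refine ext_of_getD (by omega) fun k hk => ?_
  rw [h.left_eq k hk, h'.left_eq k (by omega)]
  have q1 := key h k (by omega) (by omega)
  have q2 := key h' k (by omega) (by omega)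
  have := q1.1.trans q2.1.symm
  omega

end IsRep
end RotWord
-- Counting the pairs when the hits form a progression
namespace RotWord

variable {H : ℤ → Prop} {n : ℤ} {α x c α' x' c' : ℝ}

/-- `H` is the progression `a, a + d, …, a + k d` in `[0, n]`. -/
structure IsProgression (H : ℤ → Prop) (n a d k : ℤ) : Prop where
  start_nonneg : 0 ≤ a
  last_le : a + k * d ≤ n
  one_le : 1 ≤ k
  gap_pos : 1 ≤ d
  iff_exists : ∀ t, 0 ≤ t → t ≤ n → (H t ↔ ∃ m, 0 ≤ m ∧ m ≤ k ∧ t = a + m * d)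

namespace IsProgression
variable {a d k : ℤ}

lemma start_mem (P : IsProgression H n a d k) : H a := by
  have := P.start_nonneg
  have := P.last_le
  have := P.one_le
  have := P.gap_pos
  rw [P.iff_exists a (by omega) (by nlinarith)]
  exact ⟨0, le_rfl, by omega, by ring⟩

lemma last_mem (P : IsProgression H n a d k) : H (a + k * d) := by
  have := P.start_nonneg
  have := P.last_le
  have := P.one_le
  have := P.gap_pos
  rw [P.iff_exists _ (by nlinarith) (by omega)]
  exact ⟨k, by omega, le_rfl, rfl⟩

lemma not_mem_of_lt (P : IsProgression H n a d k) {t : ℤ} (h0 : 0 ≤ t) (h : t < a) : ¬ H t := by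
  have := P.last_le
  have := P.one_le
  have := P.gap_pos
  rw [P.iff_exists t h0 (by nlinarith)]
  rintro ⟨m, hm, -, rfl⟩
  nlinarith

lemma not_mem_of_gt (P : IsProgression H n a d k) {t : ℤ} (h : a + k * d < t) (htn : t ≤ n) :
    ¬ H t := by
  have := P.start_nonneg
  have := P.one_le
  have := P.gap_pos
  rw [P.iff_exists t (by nlinarith) htn]
  rintro ⟨m, hm, hmk, rfl⟩
  nlinarith

lemma consec (P : IsProgression H n a d k) : Consec H n a (a + d) := by
  have h1 := P.start_nonneg
  have h2 := P.last_le
  have h3 := P.one_le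
  have h4 := P.gap_pos
  have h5 : d ≤ k * d := by nlinarith
  refine ⟨h1, by omega, by omega, P.start_mem, ?_, fun r hr hr' => ?_⟩
  · rw [P.iff_exists _ (by omega) (by omega)]
    exact ⟨1, by omega, h3, by ring⟩
  · rw [P.iff_exists _ (by omega) (by omega)]
    rintro ⟨m, hm, hmk, rfl⟩
    have : 0 < m := by
      by_contra! h
      nlinarith
    nlinarith

lemma sub_eq (P : IsProgression H n a d k) {s t : ℤ} (h : Consec H n s t) : t - s = d := by
  have h4 := P.gap_pos
  obtain ⟨h0, hlt, htn, Hs, Ht, hno⟩ := h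
  obtain ⟨m, hm, hmk, rfl⟩ := (P.iff_exists s h0 (by omega)).1 Hs
  obtain ⟨m', hm', hmk', rfl⟩ := (P.iff_exists t (by omega) htn).1 Ht
  have hmm : m + 1 ≤ m' := by
    by_contra! h
    nlinarith
  have hmul : (m + 1) * d ≤ m' * d := mul_le_mul_of_nonneg_right hmm (by omega)
  have hH : H (a + (m + 1) * d) := by
    rw [P.iff_exists _ (by nlinarith) (by omega)]
    exact ⟨m + 1, by omega, by omega, rfl⟩
  have : ¬ a + (m + 1) * d < a + m' * d := fun hl => hno _ (by nlinarith) hl hH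
  nlinarith

lemma height_sub_eq (P : IsProgression H n a d k) (S : IsStrip H n α x c) (hd : 2 ≤ d) {s t : ℤ}
    (h : Consec H n s t) :
    height α x t - height α x s = height α x (a + d) - height α x a := by
  refine (Consec.iff_of_adjacent (P := fun s t =>
    height α x t - height α x s = height α x (a + d) - height α x a) ?_ h P.consec).2 rfl
  intro s t r h h'
  have e1 := P.sub_eq h
  have e2 := P.sub_eq h'
  rw [S.height_sub_eq_of_gap_eq h h' (by omega) (by omega)]

lemma agree_or_opposite (P : IsProgression H n a d k) (hd : 2 ≤ d) (S : IsStrip H n α x c)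
    (S' : IsStrip H n α' x' c')
    (hp : height α x (a + d) - height α x a = height α' x' (a + d) - height α' x' a) :
    (∀ t, 0 ≤ t → t ≤ n →
      height α x t - height α x a = height α' x' t - height α' x' a) ∨
      Opposite H n α x α' x' ∨ Opposite H n α' x' α x := by
  have := P.one_le
  refine opposite_of_height_sub_eq S S' P.start_nonneg (b := a + k * d) (by nlinarith) P.last_le
    P.start_mem P.last_mem (fun t h0 h => P.not_mem_of_lt h0 h) (fun t h h' => P.not_mem_of_gt h h')
    fun s t h => ?_
  rw [P.height_sub_eq S hd h, P.height_sub_eq S' hd h, hp]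

/-- The witness τ would be a non-hit at distance d beyond the first or the last hit, which is
outside [0, n]. -/
lemma not_opposite (P : IsProgression H n a d k) (ha : a < d) (hb : n - (a + k * d) < d) :
    ¬ Opposite H n α x α' x' := by
  rintro ⟨-, τ, h0, hn, hH, hτ⟩
  have := P.start_nonneg
  have := P.last_le
  have h4 := P.gap_pos
  rcases hτ a (a + d) P.consec with ⟨h, h'⟩ | ⟨h, h'⟩
  · rw [P.iff_exists _ (by omega) (by omega)] at h'
    obtain ⟨m, hm, hmk, e⟩ := h'
    rcases eq_or_lt_of_le hmk with rfl | hlt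
    · omega
    · refine hH ((P.iff_exists τ h0 hn).2 ⟨m + 1, by omega, by omega, ?_⟩)
      linarith
  · have hc := P.consec
    rw [P.iff_exists _ (by omega) (by have := hc.2.2.1; omega)] at h'
    obtain ⟨m, hm, hmk, e⟩ := h'
    have : m < 1 := by
      by_contra! h1
      nlinarith
    obtain rfl : m = 0 := by omega
    omega

/-- Strips that drift upwards and downwards can be told apart at a distance `d` from the hits. -/
lemma not_agree (P : IsProgression H n a d k) (S : IsStrip H n α x c) (S' : IsStrip H n α' x' c')
    (hlong : d ≤ a ∨ d ≤ n - (a + k * d)) (hup : offset α x a < offset α x (a + d))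
    (hdown : offset α' x' (a + d) < offset α' x' a) :
    ¬ ∀ t, 0 ≤ t → t ≤ n →
      height α x t - height α x a = height α' x' t - height α' x' a := by
  intro hag
  have h1 := P.start_nonneg
  have h2 := P.last_le
  have h3 := P.one_le
  have h4 := P.gap_pos
  have h5 : d ≤ k * d := by nlinarith
  have hp := hag (a + d) (by omega) (by omega)
  have incr : ∀ β y : ℝ, offset β y (a + d) - offset β y a =
      d * β - (height β y (a + d) - height β y a) := by
    intro β y
    unfold offset
    push_cast
    ring
  have i1 := incr α x
  have i2 := incr α' x'
  -- Extend the progression of integer points by one gap vector. Before the first hit, the new point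
  -- is above the upward-drifting line but under the downward-drifting one; after the last hit it is
  -- the other way round.
  rcases hlong with hl | hl
  · have hτ := hag (a - d) (by omega) (by omega)
    have hno := P.not_mem_of_lt (t := a - d) (by omega) (by omega)
    have q1 : height α' x' a - (height α' x' (a + d) - height α' x' a) ≤ height α' x' (a - d) := by
      rw [le_height]
      have := offset_nonneg α' x' a
      unfold offset at this i2 hdown
      push_cast at *
      linarith
    have q2 : ¬ height α x a - (height α x (a + d) - height α x a) ≤ height α x (a - d) := by
      intro h
      have ho := (S.iff_offset a h1 (by omega)).1 P.start_mem
      have := S.not_mem_ge (by omega) (by omega) hno (le_height.1 h)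
      unfold offset at ho i1 hup
      push_cast at *
      linarith
    omega
  · have hb := hag (a + k * d) (by omega) (by omega)
    have hτ := hag (a + k * d + d) (by omega) (by omega)
    have hno := P.not_mem_of_gt (t := a + k * d + d) (by omega) (by omega)
    have q1 : height α x (a + k * d) + (height α x (a + d) - height α x a) ≤
        height α x (a + k * d + d) := by
      rw [le_height]
      have := offset_nonneg α x (a + k * d)
      unfold offset at this i1 hup
      push_cast at *
      linarith
    have q2 : ¬ height α' x' (a + k * d) + (height α' x' (a + d) - height α' x' a) ≤
        height α' x' (a + k * d + d) := by
      intro h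
      have ho := (S'.iff_offset (a + k * d) (by omega) (by omega)).1 P.last_mem
      have := S'.not_mem_ge (by omega) (by omega) hno (le_height.1 h)
      unfold offset at ho i2 hdown
      push_cast at *
      linarith
    omega

/-- At time t, d times the offset is an integer z plus (t - a)δ + d o. By `hsmall`, an offset below
c forces z = 0. Then d divides t - a, the offset is o + mδ, and `hmul` selects exactly the hits. -/
lemma isStrip_of_drift (P : IsProgression H n a d k) {p : ℤ} (hcop : IsCoprime d p) {δ o : ℝ}
    (ho : 0 ≤ o) (hoc : o < c) (hmul : ∀ m : ℤ, 0 ≤ o + m * δ ∧ o + m * δ < c ↔ 0 ≤ m ∧ m ≤ k)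
    (hsmall : n * |δ| + d * c ≤ 1) :
    IsStrip H n ((p + δ) / d) (o - a * ((p + δ) / d)) c ∧ ∀ m : ℤ, 0 ≤ m → m ≤ k →
      height ((p + δ) / d) (o - a * ((p + δ) / d)) (a + m * d) = m * p ∧
      offset ((p + δ) / d) (o - a * ((p + δ) / d)) (a + m * d) = o + m * δ := by
  have h1 := P.start_nonneg
  have h2 := P.last_le
  have h3 := P.one_le
  have h4 := P.gap_pos
  have hdR : (1 : ℝ) ≤ d := by exact_mod_cast h4
  have hnR : (0 : ℝ) ≤ n := by exact_mod_cast (by nlinarith : 0 ≤ n)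
  have hnδ : 0 ≤ n * |δ| := by positivity
  have hc1 : c ≤ 1 := by nlinarith
  set α := (p + δ) / d with hα
  have hdα : d * α = p + δ := by rw [hα]; field_simp
  set x := o - a * α with hx
  have hval : ∀ m : ℤ, 0 ≤ m → m ≤ k →
      height α x (a + m * d) = m * p ∧ offset α x (a + m * d) = o + m * δ := by
    intro m hm hmk
    obtain ⟨g1, g2⟩ := (hmul m).2 ⟨hm, hmk⟩
    have e : ((a + m * d : ℤ) : ℝ) * α + x - ((m * p : ℤ) : ℝ) = o + m * δ := by
      rw [hx]
      push_cast
      linear_combination m * hdα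
    have hh : height α x (a + m * d) = m * p := height_eq (by rw [e]; exact g1) (by rw [e]; linarith)
    refine ⟨hh, ?_⟩
    unfold offset
    rw [hh, e]
  refine ⟨⟨hc1, fun t ht htn => ⟨fun hH => ?_, fun hlt => ?_⟩⟩, hval⟩
  · obtain ⟨m, hm, hmk, rfl⟩ := (P.iff_exists t ht htn).1 hH
    rw [(hval m hm hmk).2]
    exact ((hmul m).2 ⟨hm, hmk⟩).2
  · have h0 := offset_nonneg α x t
    set z := (t - a) * p - height α x t * d with hz
    have key : d * offset α x t = z + ((t - a : ℤ) : ℝ) * δ + d * o := by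
      rw [hz, hx]
      unfold offset
      push_cast
      linear_combination (t - a : ℝ) * hdα
    have hT : |((t - a : ℤ) : ℝ) * δ| ≤ n * |δ| := by
      rw [abs_mul]
      refine mul_le_mul_of_nonneg_right ?_ (abs_nonneg _)
      rw [← Int.cast_abs]
      have h5 : 0 ≤ k * d := by positivity
      exact_mod_cast (abs_le.2 ⟨by omega, by omega⟩ : |t - a| ≤ n)
    obtain ⟨hT1, hT2⟩ := abs_le.1 hT
    have hlt' : d * offset α x t < d * c := mul_lt_mul_of_pos_left hlt (by linarith)
    have ho' : d * o < d * c := mul_lt_mul_of_pos_left hoc (by linarith)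
    have ho0 : 0 ≤ d * o := by positivity
    have h0' : 0 ≤ d * offset α x t := by positivity
    rcases lt_trichotomy z 0 with hz0 | hz0 | hz0
    · have : (z : ℝ) ≤ -1 := by exact_mod_cast (by omega : z ≤ -1)
      linarith
    · obtain ⟨m, hm⟩ : d ∣ t - a := hcop.dvd_of_dvd_mul_right ⟨height α x t, by linarith⟩
      have hmR : ((t - a : ℤ) : ℝ) = d * m := by rw [hm]; push_cast; ring
      have e : offset α x t = o + m * δ := by
        have : (d : ℝ) ≠ 0 := by positivity
        rw [hz0, hmR] at key
        refine mul_left_cancel₀ this ?_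
        rw [key]
        push_cast
        ring
      rw [e] at h0 hlt
      obtain ⟨g1, g2⟩ := (hmul m).1 ⟨h0, hlt⟩
      exact (P.iff_exists t ht htn).2 ⟨m, g1, g2, by linarith⟩
    · have : (1 : ℝ) ≤ z := by exact_mod_cast (by omega : 1 ≤ z)
      linarith

lemma exists_strip (P : IsProgression H n a d k) {p : ℤ} (hcop : IsCoprime d p) (hp : 1 ≤ p)
    (hpd : 2 * p < d) :
    (∃ α x c, 0 < α ∧ α < 1 / 2 ∧ 0 < c ∧ IsStrip H n α x c ∧
      height α x (a + d) - height α x a = p ∧ offset α x a < offset α x (a + d)) ∧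
    ∃ α x c, 0 < α ∧ α < 1 / 2 ∧ 0 < c ∧ IsStrip H n α x c ∧
      height α x (a + d) - height α x a = p ∧ offset α x (a + d) < offset α x a := by
  have h1 := P.start_nonneg
  have h2 := P.last_le
  have h3 := P.one_le
  have h4 := P.gap_pos
  have hkR : (1 : ℝ) ≤ k := by exact_mod_cast h3
  have hdR : (1 : ℝ) ≤ d := by exact_mod_cast h4
  have hpR : (1 : ℝ) ≤ p := by exact_mod_cast hp
  have hpdR : 2 * (p : ℝ) + 1 ≤ d := by exact_mod_cast hpd
  have hnR : (0 : ℝ) ≤ n := by exact_mod_cast (by nlinarith : 0 ≤ n)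
  -- With c = (k + 1)δ this gives nδ + dc = 1 - δ, as the smallness condition requires, and δ < 1/2
  -- keeps (p ± δ)/d inside (0, 1/2). The offsets at the hits run through 0, δ, …, kδ upwards or
  -- downwards.
  set δ : ℝ := 1 / (n + d * (k + 1) + 1) with hδ
  have hpos : 0 < δ := by positivity
  have hδn : n * δ + d * ((k + 1) * δ) + δ = 1 := by
    rw [hδ]
    field_simp
  have hδ2 : δ < 1 / 2 := by
    have : 0 ≤ n * δ := by positivity
    have : (1 : ℝ) * (2 * δ) ≤ d * ((k + 1) * δ) := by gcongr; linarith
    linarith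
  constructor
  · have hS := P.isStrip_of_drift hcop (δ := δ) (o := 0) (c := (k + 1) * δ) le_rfl (by positivity)
      (fun m => by
        rw [zero_add, mul_nonneg_iff_of_pos_right hpos, mul_lt_mul_iff_left₀ hpos]
        norm_cast
        omega)
      (by rw [abs_of_pos hpos]; linarith)
    refine ⟨_, _, _, ?_, ?_, ?_, hS.1, ?_, ?_⟩
    · positivity
    · rw [div_lt_div_iff₀ (by linarith) (by norm_num)]
      linarith
    · positivity
    · have e0 := (hS.2 0 le_rfl (by omega)).1
      have e1 := (hS.2 1 (by omega) h3).1
      simp only [zero_mul, one_mul, add_zero] at e0 e1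
      rw [e0, e1, sub_zero]
    · have e0 := (hS.2 0 le_rfl (by omega)).2
      have e1 := (hS.2 1 (by omega) h3).2
      simp only [zero_mul, one_mul, add_zero, Int.cast_zero, Int.cast_one] at e0 e1
      rw [e0, e1]
      linarith
  · have hS := P.isStrip_of_drift hcop (δ := -δ) (o := k * δ) (c := (k + 1) * δ) (by positivity)
      (by linarith)
      (fun m => by
        have e : k * δ + m * -δ = ((k - m : ℤ) : ℝ) * δ := by push_cast; ring
        rw [e, mul_nonneg_iff_of_pos_right hpos, mul_lt_mul_iff_left₀ hpos]
        norm_cast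
        omega)
      (by rw [abs_neg, abs_of_pos hpos]; linarith)
    refine ⟨_, _, _, ?_, ?_, ?_, hS.1, ?_, ?_⟩
    · have : 0 < p + -δ := by linarith
      positivity
    · rw [div_lt_div_iff₀ (by linarith) (by norm_num)]
      linarith
    · positivity
    · have e0 := (hS.2 0 le_rfl (by omega)).1
      have e1 := (hS.2 1 (by omega) h3).1
      simp only [zero_mul, one_mul, add_zero] at e0 e1
      rw [e0, e1, sub_zero]
    · have e0 := (hS.2 0 le_rfl (by omega)).2
      have e1 := (hS.2 1 (by omega) h3).2
      simp only [zero_mul, one_mul, add_zero, Int.cast_zero, Int.cast_one] at e0 e1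
      rw [e0, e1]
      linarith

end IsProgression

/-- The numerators of the reduced fractions in `(0, 1/2)` with denominator `d`. -/
def halfUnits (d : ℕ) : Finset ℕ := (Finset.range d).filter fun p => d.Coprime p ∧ 2 * p < d

/-- The reflection p ↦ d - p exchanges the two halves of the units modulo d; for d ≥ 3 no unit is 0
or d/2. -/
lemma two_mul_card_halfUnits {d : ℕ} (hd : 3 ≤ d) : 2 * (halfUnits d).card = d.totient := by
  have hpos : ∀ p, d.Coprime p → p ≠ 0 := by
    rintro p hp rfl
    simp at hp
    omega
  have hne : ∀ p, d.Coprime p → 2 * p ≠ d := by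
    rintro p hp rfl
    have := Nat.Coprime.coprime_mul_left hp
    simp at this
    omega
  rw [Nat.totient_eq_card_coprime, ← Finset.card_filter_add_card_filter_not
    (s := (Finset.range d).filter d.Coprime) (fun p => 2 * p < d),
    Finset.filter_filter, Finset.filter_filter, two_mul]
  refine congrArg₂ _ rfl (Finset.card_bij' (fun p _ => d - p) (fun p _ => d - p) ?_ ?_ ?_ ?_)
  · intro p hp
    simp only [halfUnits, Finset.mem_filter, Finset.mem_range] at hp ⊢
    have := hpos p hp.2.1
    refine ⟨by omega, ?_, by omega⟩
    rw [Nat.coprime_self_sub_right hp.1.le]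
    exact hp.2.1
  · intro p hp
    simp only [halfUnits, Finset.mem_filter, Finset.mem_range] at hp ⊢
    have := hpos p hp.2.1
    have := hne p hp.2.1
    refine ⟨by omega, ?_, by omega⟩
    rw [Nat.coprime_self_sub_right hp.1.le]
    exact hp.2.1
  · intro p hp
    simp only [halfUnits, Finset.mem_filter, Finset.mem_range] at hp
    omega
  · intro p hp
    simp only [Finset.mem_filter, Finset.mem_range] at hp
    omega

/-- Let f p and g p be pairs with numerator p that drift up and down. A pair determines p, so f and
g are injective. In a short word the image of f is everything; otherwise the images of f and g are
disjoint and together exhaust the pairs. -/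
theorem ncard_generatingPairs {w : Word} {n a d k : ℕ} (hw : w.length = n + 1) (h0 : 0 ∈ w)
    (h1 : 1 ∈ w) (P : IsProgression (Ones w) n a d k) (hd : 3 ≤ d) :
    (generatingPairs w).ncard =
      if a < d ∧ n - (a + k * d) < d then d.totient / 2 else d.totient := by
  have hlen : (w.length - 1 : ℤ) = n := by omega
  have hc := P.consec
  have hex : ∀ p ∈ halfUnits d, (∃ u v α x c, IsRep w u v α x c ∧
      height α x (a + d) - height α x a = p ∧ offset α x a < offset α x (a + d)) ∧
      ∃ u v α x c, IsRep w u v α x c ∧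
      height α x (a + d) - height α x a = p ∧ offset α x (a + d) < offset α x a := by
    intro p hp
    simp only [halfUnits, Finset.mem_filter, Finset.mem_range] at hp
    obtain ⟨-, hcop, hpd⟩ := hp
    have hp0 : p ≠ 0 := by
      rintro rfl
      simp at hcop
      omega
    obtain ⟨⟨α, x, c, g1, g2, g3, g4, g5⟩, ⟨α', x', c', g1', g2', g3', g4', g5'⟩⟩ :=
      P.exists_strip (p := p) (Nat.isCoprime_iff_coprime.2 hcop) (by omega) (by omega)
    obtain ⟨u, v, R⟩ := IsRep.exists_of_isStrip hw g1 g2 g3 g4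
    obtain ⟨u', v', R'⟩ := IsRep.exists_of_isStrip hw g1' g2' g3' g4'
    exact ⟨⟨u, v, α, x, c, R, g5⟩, ⟨u', v', α', x', c', R', g5'⟩⟩
  have hall : ∀ {u v α x c}, IsRep w u v α x c → ∃ p ∈ halfUnits d,
      height α x (a + d) - height α x a = (p : ℤ) := by
    intro u v α x c R
    have S := R.strip
    rw [hlen] at S
    have hcop := S.isCoprime hc
    obtain ⟨g1, g2⟩ := S.two_mul_le R.slope_pos.le R.slope_lt hc (by omega)
    obtain ⟨p, hp⟩ := Int.eq_ofNat_of_zero_le (show 0 ≤ height α x (a + d) - height α x a by omega)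
    rw [hp, add_sub_cancel_left] at hcop g2
    rw [hp] at g1
    have hcop' := Nat.isCoprime_iff_coprime.1 hcop
    refine ⟨p, ?_, hp⟩
    simp only [halfUnits, Finset.mem_filter, Finset.mem_range]
    refine ⟨by omega, hcop', ?_⟩
    have : 2 * p ≠ d := by
      rintro rfl
      have := Nat.Coprime.coprime_mul_left hcop'
      simp at this
      omega
    omega
  have hsame : ∀ {u v α x c α' x' c'}, IsRep w u v α x c → IsRep w u v α' x' c' →
      ∀ t : ℤ, 0 ≤ t → t ≤ n →
      height α x t - height α x a = height α' x' t - height α' x' a := by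
    intro u v α x c α' x' c' R R' t ht htn
    exact R.height_sub_eq R' (by omega) (by have := hc.2.2.1; omega) ht (by omega)
  have htot := two_mul_card_halfUnits hd
  have hfirst : (a + d : ℤ) ≤ n := hc.2.2.1
  have hplus : ∀ p, ∃ q : Word × Word, p ∈ halfUnits d → ∃ α x c, IsRep w q.1 q.2 α x c ∧
      height α x (a + d) - height α x a = p ∧ offset α x a < offset α x (a + d) := by
    intro p
    by_cases hp : p ∈ halfUnits d
    · obtain ⟨u, v, h⟩ := (hex p hp).1
      exact ⟨(u, v), fun _ => h⟩
    -- A dummy pair outside `halfUnits d`, so that f is a total function.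
    · exact ⟨([], []), fun h => absurd h hp⟩
  have hminus : ∀ p, ∃ q : Word × Word, p ∈ halfUnits d → ∃ α x c, IsRep w q.1 q.2 α x c ∧
      height α x (a + d) - height α x a = p ∧ offset α x (a + d) < offset α x a := by
    intro p
    by_cases hp : p ∈ halfUnits d
    · obtain ⟨u, v, h⟩ := (hex p hp).2
      exact ⟨(u, v), fun _ => h⟩
    · exact ⟨([], []), fun h => absurd h hp⟩
  choose f hf using hplus
  choose g hg using hminus
  have hstrip : ∀ {u v α x c}, IsRep w u v α x c → IsStrip (Ones w) n α x c := by
    intro u v α x c R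
    rw [← hlen]
    exact R.strip
  have heq : ∀ {u v u' v' α x c α' x' c'}, IsRep w u v α x c → IsRep w u' v' α' x' c' →
      (∀ t : ℤ, 0 ≤ t → t ≤ n →
      height α x t - height α x a = height α' x' t - height α' x' a) → (u, v) = (u', v') := by
    intro u v u' v' α x c α' x' c' R R' h
    exact R.pair_eq R' (a := a) (fun t ht htn => h t ht (by omega))
  have hinj : ∀ {q : Word × Word} {p p' : ℕ} {α x c α' x' c'}, IsRep w q.1 q.2 α x c →
      IsRep w q.1 q.2 α' x' c' → height α x (a + d) - height α x a = p →
      height α' x' (a + d) - height α' x' a = p' → p = p' := by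
    intro q p p' α x c α' x' c' R R' e e'
    have := hsame R R' (a + d) (by omega) hfirst
    omega
  have hfinj : Set.InjOn f (halfUnits d) := by
    intro p hp p' hp' h
    obtain ⟨α, x, c, R, e, -⟩ := hf p hp
    obtain ⟨α', x', c', R', e', -⟩ := hf p' hp'
    rw [← h] at R'
    exact hinj R R' e e'
  have hginj : Set.InjOn g (halfUnits d) := by
    intro p hp p' hp' h
    obtain ⟨α, x, c, R, e, -⟩ := hg p hp
    obtain ⟨α', x', c', R', e', -⟩ := hg p' hp'
    rw [← h] at R'
    exact hinj R R' e e'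
  have hfmem : ∀ p ∈ halfUnits d, f p ∈ generatingPairs w := by
    intro p hp
    obtain ⟨α, x, c, R, -⟩ := hf p hp
    exact (mem_generatingPairs_iff h0 h1).2 ⟨α, x, c, R⟩
  have hgmem : ∀ p ∈ halfUnits d, g p ∈ generatingPairs w := by
    intro p hp
    obtain ⟨α, x, c, R, -⟩ := hg p hp
    exact (mem_generatingPairs_iff h0 h1).2 ⟨α, x, c, R⟩
  split_ifs with hshort
  · have himage : generatingPairs w = f '' halfUnits d := by
      ext q
      constructor
      · intro hq
        obtain ⟨α, x, c, R⟩ := (mem_generatingPairs_iff h0 h1).1 hq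
        obtain ⟨p, hp, e⟩ := hall R
        obtain ⟨α', x', c', R', e', -⟩ := hf p hp
        refine ⟨p, hp, ?_⟩
        have hb : (n : ℤ) - (a + k * d) < d := by
          have := hshort.2
          omega
        rcases P.agree_or_opposite (by omega) (hstrip R') (hstrip R) (e'.trans e.symm) with
          h | h | h
        · exact heq R' R h
        · exact absurd h (P.not_opposite (by omega) hb)
        · exact absurd h (P.not_opposite (by omega) hb)
      · rintro ⟨p, hp, rfl⟩
        exact hfmem p hp
    rw [himage, hfinj.ncard_image, Set.ncard_coe_finset]
    omega
  · have himage : generatingPairs w = f '' halfUnits d ∪ g '' halfUnits d := by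
      ext q
      constructor
      · intro hq
        obtain ⟨α, x, c, R⟩ := (mem_generatingPairs_iff h0 h1).1 hq
        obtain ⟨p, hp, e⟩ := hall R
        obtain ⟨α₁, x₁, c₁, R₁, e₁, o₁⟩ := hf p hp
        obtain ⟨α₂, x₂, c₂, R₂, e₂, o₂⟩ := hg p hp
        -- If the given strip is not equivalent to the upward one, it is opposite to it and drifts
        -- down, so it cannot be opposite to the downward one as well.
        rcases P.agree_or_opposite (by omega) (hstrip R₁) (hstrip R) (e₁.trans e.symm) with
          h | h | h
        · exact .inl ⟨p, hp, heq R₁ R h⟩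
        · rcases P.agree_or_opposite (by omega) (hstrip R₂) (hstrip R) (e₂.trans e.symm) with
            h' | h' | h'
          · exact .inr ⟨p, hp, heq R₂ R h'⟩
          · have := (h'.1 _ _ hc).1
            linarith
          · have := (h'.1 _ _ hc).1
            have := (h.1 _ _ hc).2
            linarith
        · have := (h.1 _ _ hc).2
          linarith
      · rintro (⟨p, hp, rfl⟩ | ⟨p, hp, rfl⟩)
        · exact hfmem p hp
        · exact hgmem p hp
    have hdisj : Disjoint (f '' halfUnits d) (g '' halfUnits d) := by
      rw [Set.disjoint_left]
      rintro q ⟨p, hp, rfl⟩ ⟨p', hp', h⟩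
      obtain ⟨α, x, c, R, -, o⟩ := hf p hp
      obtain ⟨α', x', c', R', -, o'⟩ := hg p' hp'
      rw [h] at R'
      refine P.not_agree (hstrip R) (hstrip R') ?_ o o' (hsame R R')
      have := P.last_le
      have e : ((a + k * d : ℕ) : ℤ) = a + k * d := by push_cast; rfl
      omega
    rw [himage, Set.ncard_union_eq hdisj ((Finset.finite_toSet _).image _)
      ((Finset.finite_toSet _).image _), hfinj.ncard_image,
      hginj.ncard_image, Set.ncard_coe_finset]
    omega

end RotWord
-- The periodic form of the word
namespace RotWord

lemma length_periodicForm (a b : Fin 2) (i l k j : ℕ) :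
    (periodicForm a b i l k j).length = i + k * (l + 1) + 1 + j := by
  simp [periodicForm]
  ring

lemma getD_periodicForm_eq_one (i l k j t : ℕ) :
    (periodicForm 0 1 i l k j).getD t 0 = 1 ↔ ∃ m ≤ k, t = i + m * (l + 1) := by
  have key : ∀ k t : ℕ, ((List.replicate k ((1 : Fin 2) :: List.replicate l 0)).flatten ++
      1 :: List.replicate j 0).getD t 0 = 1 ↔ ∃ m ≤ k, t = m * (l + 1) := by
    intro k
    induction k with
    | zero =>
      intro t
      rcases t with _ | t
      · simp
      · have : (List.replicate j (0 : Fin 2)).getD t 0 = 0 := by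
          rw [List.getD_eq_getElem?_getD, List.getElem?_replicate]
          split_ifs <;> rfl
        rw [List.replicate_zero, List.flatten_nil, List.nil_append, List.getD_cons_succ, this]
        refine iff_of_false (by decide) ?_
        rintro ⟨m, hm, e⟩
        obtain rfl : m = 0 := by omega
        simp at e
    | succ k ih =>
      intro t
      rw [List.replicate_succ, List.flatten_cons, List.append_assoc]
      rcases lt_or_ge t (l + 1) with h | h
      · rw [List.getD_append _ _ _ _ (by simpa using h)]
        rcases t with _ | t
        · simp only [List.getD_cons_zero, true_iff]
          exact ⟨0, by omega, by simp⟩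
        · have : (List.replicate l (0 : Fin 2)).getD t 0 = 0 := by
            rw [List.getD_eq_getElem?_getD, List.getElem?_replicate]
            split_ifs <;> rfl
          rw [List.getD_cons_succ, this]
          refine iff_of_false (by decide) ?_
          rintro ⟨m, -, hm⟩
          rcases m with _ | m
          · simp at hm
          · rw [Nat.succ_mul] at hm
            omega
      · rw [List.getD_append_right _ _ _ _ (by simpa using h), ih]
        simp only [List.length_cons, List.length_replicate]
        constructor
        · rintro ⟨m, hm, e⟩
          exact ⟨m + 1, by omega, by rw [Nat.succ_mul]; omega⟩
        · rintro ⟨m, hm, e⟩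
          rcases m with _ | m
          · omega
          · exact ⟨m, by omega, by rw [Nat.succ_mul] at e; omega⟩
  unfold periodicForm
  rw [List.append_assoc]
  rcases lt_or_ge t i with h | h
  · rw [List.getD_append _ _ _ _ (by simpa using h)]
    have : (List.replicate i (0 : Fin 2)).getD t 0 = 0 := by
      rw [List.getD_eq_getElem?_getD, List.getElem?_replicate]
      split_ifs <;> rfl
    rw [this]
    refine iff_of_false (by decide) ?_
    rintro ⟨m, -, hm⟩
    omega
  · rw [List.getD_append_right _ _ _ _ (by simpa using h), key]
    simp only [List.length_replicate]
    refine exists_congr fun m => and_congr_right fun _ => ?_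
    omega

lemma exists_ones_of_two_le_count {w : Word} (h : 2 ≤ w.count 1) :
    ∃ s t : ℤ, 0 ≤ s ∧ s < t ∧ t ≤ w.length - 1 ∧ Ones w s ∧ Ones w t := by
  rw [← List.duplicate_iff_two_le_count, List.duplicate_iff_exists_distinct_get] at h
  obtain ⟨s, t, hst, h1, h2⟩ := h
  have h3 : (s : ℕ) < t := hst
  have h4 := t.2
  refine ⟨(s : ℕ), (t : ℕ), by omega, by exact_mod_cast h3, by omega, ?_, ?_⟩
  · unfold Ones
    rw [Int.toNat_natCast, List.getD_eq_getElem _ _ s.2]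
    exact h1.symm
  · unfold Ones
    rw [Int.toNat_natCast, List.getD_eq_getElem _ _ t.2]
    exact h2.symm

/-- The theorem for words in which the ones are isolated. -/
theorem exists_periodicForm_of_isolated {w : Word} (h0 : 0 ∈ w) (h1 : 2 ≤ w.count 1)
    (h11 : ¬ ∃ t : ℤ, 0 ≤ t ∧ t + 1 ≤ w.length - 1 ∧ Ones w t ∧ Ones w (t + 1))
    (hgen : ∃ p ∈ generatingPairs w, ∃ q ∈ generatingPairs w, p ≠ q) :
    ∃ i j l k : ℕ, 2 ≤ l ∧ 1 ≤ k ∧ w = periodicForm 0 1 i l k j ∧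
      (generatingPairs w).ncard =
        if i ≤ l ∧ j ≤ l then Nat.totient (l + 1) / 2 else Nat.totient (l + 1) := by
  have h1' : 1 ∈ w := List.count_pos_iff.1 (by omega)
  obtain ⟨⟨u, v⟩, hp, ⟨u', v'⟩, hq, hne⟩ := hgen
  obtain ⟨α, x, c, R⟩ := (mem_generatingPairs_iff h0 h1').1 hp
  obtain ⟨α', x', c', R'⟩ := (mem_generatingPairs_iff h0 h1').1 hq
  obtain ⟨s, t, hs, hst, ht, Hs, Ht⟩ := exists_ones_of_two_le_count h1
  obtain ⟨a, ⟨ha0, haw, Ha⟩, ha⟩ := Int.exists_least_of_bdd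
    (P := fun s : ℤ => 0 ≤ s ∧ s ≤ w.length - 1 ∧ Ones w s) ⟨0, fun z hz => hz.1⟩
    ⟨s, hs, by omega, Hs⟩
  obtain ⟨b, ⟨hb0, hbw, Hb⟩, hb⟩ := Int.exists_greatest_of_bdd
    (P := fun s : ℤ => 0 ≤ s ∧ s ≤ w.length - 1 ∧ Ones w s) ⟨_, fun z hz => hz.2.1⟩
    ⟨s, hs, by omega, Hs⟩
  have has := ha s ⟨hs, by omega, Hs⟩
  have hbt := hb t ⟨by omega, ht, Ht⟩
  have hmin : ∀ t, 0 ≤ t → t < a → ¬ Ones w t := by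
    intro t h h' hH
    have := ha t ⟨h, by omega, hH⟩
    omega
  have hmax : ∀ t : ℤ, b < t → t ≤ w.length - 1 → ¬ Ones w t := by
    intro t h h' hH
    have := hb t ⟨by omega, h', hH⟩
    omega
  have h2 : ∀ s t, Consec (Ones w) (w.length - 1) s t → 2 ≤ t - s := by
    intro s t ⟨g0, g1, g2, g3, g4, g5⟩
    by_contra! h
    obtain rfl : t = s + 1 := by omega
    exact h11 ⟨s, g0, g2, g3, g4⟩
  have hopp : (∀ s t, Consec (Ones w) (w.length - 1) s t →
      height α x t - height α x s = height α' x' t - height α' x' s) →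
      Opposite (Ones w) (w.length - 1) α x α' x' ∨
        Opposite (Ones w) (w.length - 1) α' x' α x := by
    intro hag
    exact (opposite_of_height_sub_eq R.strip R'.strip ha0 (by omega) hbw Ha Hb hmin hmax
      hag).resolve_left fun h => hne (R.pair_eq R' h)
  have hgap : ∀ s t r, Consec (Ones w) (w.length - 1) s t → Consec (Ones w) (w.length - 1) t r →
      t - s = r - t := by
    rcases height_sub_eq_or_gaps_eq R.strip R'.strip R.slope_pos.le R.slope_lt R'.slope_pos.le
      R'.slope_lt h2 with hag | h
    · rcases hopp hag with h | h
      · exact h.gaps_eq R.strip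
      · exact h.gaps_eq R'.strip
    · exact h
  obtain ⟨d, k, hd, hk, hbd, hall, hiff⟩ :=
    exists_progression ha0 (by omega) hbw Ha Hb hmin hmax hgap
  have P : IsProgression (Ones w) (w.length - 1) a d k := ⟨ha0, by omega, hk, hd, hiff⟩
  have hc := P.consec
  have hd2 : 2 ≤ d := by
    have := h2 _ _ hc
    omega
  -- For gap 2 the increment is 1 and the offset changes by 2α - 1 < 0. Both strips have the same
  -- increments and so must be opposite, but neither can drift up.
  have hd3 : d ≠ 2 := by
    rintro rfl
    have hneg : ∀ {u v α x c}, IsRep w u v α x c →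
        ¬ offset α x a < offset α x (a + 2) ∧ height α x (a + 2) - height α x a = 1 := by
      intro u v α x c R
      have := R.strip.two_mul_le R.slope_pos.le R.slope_lt hc (by omega)
      have e : height α x (a + 2) - height α x a = 1 := by omega
      have eR : (height α x (a + 2) : ℝ) - height α x a = 1 := by exact_mod_cast e
      refine ⟨?_, e⟩
      have := R.slope_lt
      unfold offset
      push_cast
      linarith
    have hag : ∀ s t, Consec (Ones w) (w.length - 1) s t →
        height α x t - height α x s = height α' x' t - height α' x' s := by
      intro s t h
      rw [P.height_sub_eq R.strip le_rfl h, P.height_sub_eq R'.strip le_rfl h, (hneg R).2,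
        (hneg R').2]
    rcases hopp hag with h | h
    · exact (hneg R).1 (h.1 _ _ hc).1
    · exact (hneg R').1 (h.1 _ _ hc).1
  have hlast := P.last_le
  lift a to ℕ using ha0
  lift d to ℕ using by omega
  lift k to ℕ using by omega
  have hlen : (w.length - 1 : ℤ) = ((w.length - 1 : ℕ) : ℤ) := by omega
  rw [hlen] at P hlast
  have hlast' : a + k * d ≤ w.length - 1 := by exact_mod_cast hlast
  have hcount := ncard_generatingPairs (by omega) h0 h1' P (by omega)
  obtain ⟨l, rfl⟩ : ∃ l, d = l + 1 := ⟨d - 1, by omega⟩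
  refine ⟨a, w.length - 1 - (a + k * (l + 1)), l, k, by omega, by omega, ?_, ?_⟩
  · have hl : w.length = (periodicForm 0 1 a l k (w.length - 1 - (a + k * (l + 1)))).length := by
      rw [length_periodicForm]
      omega
    refine ext_of_getD hl fun t ht => ?_
    rw [val_eq_ite, val_eq_ite]
    refine if_congr ?_ rfl rfl
    rw [getD_periodicForm_eq_one]
    have := P.iff_exists t (by omega) (by omega)
    unfold Ones at this
    rw [Int.toNat_natCast] at this
    rw [this]
    constructor
    · rintro ⟨m, hm, hmk, e⟩
      lift m to ℕ using hm
      exact ⟨m, by omega, by exact_mod_cast e⟩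
    · rintro ⟨m, hm, e⟩
      exact ⟨m, by omega, by omega, by exact_mod_cast e⟩
  · rw [hcount]
    refine if_congr ?_ rfl rfl
    omega

/-! ### Exchange of letters and the theorem -/

/-- The word obtained by exchanging the letters `0` and `1`. -/
def compl (w : Word) : Word := w.map fun a => 1 - a

lemma compl_compl (w : Word) : compl (compl w) = w := by
  simp [compl]

lemma length_compl (w : Word) : (compl w).length = w.length := by
  simp [compl]

lemma val_getD_compl {w : Word} {k : ℕ} (hk : k < w.length) :
    (((compl w).getD k 0).val : ℤ) = 1 - (w.getD k 0).val := by
  rw [List.getD_eq_getElem _ _ (by rwa [length_compl]), List.getD_eq_getElem _ _ hk]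
  simp only [compl, List.getElem_map]
  generalize w[k] = a
  revert a
  decide

lemma count_compl (w : Word) (a : Fin 2) : (compl w).count a = w.count (1 - a) := by
  have : a = (fun b : Fin 2 => 1 - b) (1 - a) := by simp
  conv_lhs => rw [this]
  exact List.count_map_of_injective _ _ (sub_right_injective) _

lemma compl_periodicForm (i l k j : ℕ) :
    compl (periodicForm 0 1 i l k j) = periodicForm 1 0 i l k j := by
  simp [compl, periodicForm, List.map_flatten]

/-- Replacing each letter by 1 minus itself negates the increments of `w`, so u and v change roles.
-/
lemma Recurrence.compl {u v w : Word} (h : Recurrence u v w) : Recurrence v u (compl w) := by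
  obtain ⟨h1, h2, h3⟩ := h
  refine ⟨by rw [length_compl]; omega, h2.symm, fun k hk => ?_⟩
  rw [val_getD_compl (by omega), val_getD_compl (by omega), h3 k (by omega)]
  ring

lemma generatingPairs_compl (w : Word) :
    generatingPairs (compl w) = Prod.swap '' generatingPairs w := by
  rw [Set.image_swap_eq_preimage_swap]
  ext ⟨u, v⟩
  simp only [generatingPairs, Set.mem_ofPred_eq, Set.mem_preimage, Prod.swap, length_compl]
  constructor
  · rintro ⟨α, hα, hu, hv, h⟩
    exact ⟨α, hα, hv, hu, by simpa [compl_compl] using h.compl⟩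
  · rintro ⟨α, hα, hu, hv, h⟩
    exact ⟨α, hα, hv, hu, h.compl⟩

lemma ones_compl {w : Word} {t : ℤ} (h0 : 0 ≤ t) (ht : t ≤ w.length - 1) :
    Ones (compl w) t ↔ ¬ Ones w t := by
  lift t to ℕ using h0
  have := val_getD_compl (w := w) (k := t) (by omega)
  unfold Ones
  rw [Int.toNat_natCast]
  generalize (compl w).getD t 0 = a at this ⊢
  generalize w.getD t 0 = b at this ⊢
  revert a b
  decide

end RotWord

theorem theorem2 (w : RotWord.Word) (hw : RotWord.IsRotationWord w)
    (h0 : 2 ≤ w.count 0) (h1 : 2 ≤ w.count 1)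
    (hgen : ∃ p ∈ RotWord.generatingPairs w, ∃ q ∈ RotWord.generatingPairs w, p ≠ q) :
    ∃ i j l k : ℕ, 2 ≤ l ∧ 1 ≤ k ∧
      (w = RotWord.periodicForm 0 1 i l k j ∨ w = RotWord.periodicForm 1 0 i l k j) ∧
      (RotWord.generatingPairs w).ncard =
        if i ≤ l ∧ j ≤ l then Nat.totient (l + 1) / 2 else Nat.totient (l + 1) := by
  have m0 : 0 ∈ w := List.count_pos_iff.1 (by omega)
  have m1 : 1 ∈ w := List.count_pos_iff.1 (by omega)
  by_cases h11 : ∃ t : ℤ, 0 ≤ t ∧ t + 1 ≤ w.length - 1 ∧ RotWord.Ones w t ∧ RotWord.Ones w (t + 1)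
  · by_cases h00 : ∃ t : ℤ, 0 ≤ t ∧ t + 1 ≤ w.length - 1 ∧ ¬ RotWord.Ones w t ∧
        ¬ RotWord.Ones w (t + 1)
    · obtain ⟨⟨u, v⟩, hp, ⟨u', v'⟩, hq, hne⟩ := hgen
      obtain ⟨α, x, c, R⟩ := (RotWord.mem_generatingPairs_iff m0 m1).1 hp
      obtain ⟨α', x', c', R'⟩ := (RotWord.mem_generatingPairs_iff m0 m1).1 hq
      exact absurd (R.pair_eq_of_factors R' h11 h00) hne
    -- Here the zeros are isolated, so the complement has isolated ones and the same number of
    -- pairs.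
    · obtain ⟨p, hp, q, hq, hne⟩ := hgen
      obtain ⟨i, j, l, k, hl, hk, e, hcard⟩ := RotWord.exists_periodicForm_of_isolated
        (w := RotWord.compl w)
        (List.count_pos_iff.1 (by rw [RotWord.count_compl, sub_zero]; omega))
        (by rw [RotWord.count_compl, sub_self]; omega)
        (by
          rintro ⟨t, g0, g1, g2, g3⟩
          rw [RotWord.length_compl] at g1
          rw [RotWord.ones_compl (by omega) (by omega)] at g2 g3
          exact h00 ⟨t, g0, g1, g2, g3⟩)
        (by
          rw [RotWord.generatingPairs_compl]
          exact ⟨p.swap, ⟨p, hp, rfl⟩, q.swap, ⟨q, hq, rfl⟩, fun h => hne (Prod.swap_injective h)⟩)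
      refine ⟨i, j, l, k, hl, hk, .inr ?_, ?_⟩
      · rw [← RotWord.compl_periodicForm, ← e, RotWord.compl_compl]
      · rw [← hcard, RotWord.generatingPairs_compl,
          Set.ncard_image_of_injective _ Prod.swap_injective]
  · obtain ⟨i, j, l, k, hl, hk, e, hcard⟩ :=
      RotWord.exists_periodicForm_of_isolated m0 h1 h11 hgen
    exact ⟨i, j, l, k, hl, hk, .inl e, hcard⟩
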